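/- **Model.** An instance is a connected $n$-node graph $G$ whose nodes carry the identifiers $0,\dots,n-1$; every node knows $n$, its identifier and the identifier of its parent in an arbitrary spanning tree of $G$ rooted at node $0$. In a *distributed interactive proof* with $r$ rounds and $\ell$-bit messages, the nodes (each with private random coins) and an untrusted, computationally unbounded, randomized prover that knows the whole instance alternate for $r$ rounds, the last one being the prover's; in a node round every node sends $\ell$ bits to the prover, in a prover round the prover sends $\ell$ bits to every node. Then, without the prover, the nodes run a synchronous distributed verification algorithm on $G$, and each node accepts or rejects. The proof is for a language $\mathcal L$ of instances if for every instance in $\mathcal L$ a fixed honest prover makes all nodes accept with probability at least $2/3$, and for every instance outside $\mathcal L$ and every prover all nodes accept with probability at most $1/3$. $\mathcal C[c,b]$ denotes the (randomized) distributed algorithms that run in $c$ synchronous rounds, neighbours exchanging messages of $b$ bits in each round. The *view* of a node consists of its coins, the messages exchanged with the prover, and the messages received from its neighbours during verification. The language $\mathcal L$ belongs to $\mathrm{dStatZK}[r,\ell,\mathcal C[c,b]]$ (with $r,\ell,c,b$ functions of $n$) if it has a distributed interactive proof with $r$ rounds, $\ell$-bit messages and verification algorithm in $\mathcal C[c,b]$,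 together with a simulator in $\mathcal C[c,b]$ (run by the nodes without any prover, each node outputting a simulated view) such that for every $d\in\mathbb N$, for all sufficiently large $n$, for every $n$-node instance in $\mathcal L$ and every node $v$, the total variation distance between the output of the simulator at $v$ and the view of $v$ in the interaction with the honest prover is at most $n^{-d}$. **Theorem.** Let $k$ be a fixed natural number, and let Non-$k$-Colorability be the language of all instances whose graph $G$ has no proper colouring with $k$ colours. For every sequence of primes $q=q(n)$ with $q=n^{\omega(1)}$ (that is, for every $d$, $q(n)\ge n^d$ for all large $n$), $$\text{Non-}k\text{-Colorability}\in \mathrm{dStatZK}\bigl[O(n),\,O(\log q),\,\mathcal C[O(1),\,O(n\log q)]\bigr],$$ where the constants in the $O$-notation depend only on $k$. -/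

import Mathlib

open Filter

noncomputable section

/-- Strings of exactly `b` bits. -/
abbrev BitString (b : ℕ) : Type := Fin b → Bool

/-! ### Networks -/

/-- An `n`-node network. A node is identified with its identifier in `{0, …, n - 1}`. Besides its
identifier, the input label of a node is the identifier of its parent in an arbitrary spanning tree
of the connected communication graph, rooted at the node with identifier `0` (the root is recorded
as its own parent). -/
structure Network (n : ℕ) where
  graph : SimpleGraph (Fin n)
  connected : graph.Connected
  parent : Fin n → Fin n
  parent_root : ∀ v : Fin n, v.val = 0 → parent v = v
  parent_adj : ∀ v : Fin n, v.val ≠ 0 → graph.Adj v (parent v)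
  parent_reaches_root : ∀ v : Fin n, ∃ m : ℕ, (parent^[m] v).val = 0

/-- What a node knows initially (everything may moreover depend on the number `n` of nodes). -/
structure LocalInput (n : ℕ) where
  id : Fin n
  parent : Fin n

def Network.localInput {n : ℕ} (X : Network n) (v : Fin n) : LocalInput n := ⟨v, X.parent v⟩

/-- A distributed language: a set of labelled networks, of all sizes. -/
abbrev DistLanguage : Type := (n : ℕ) → Set (Network n)

/-- The networks whose communication graph has no proper colouring with `k` colours. -/
def nonColorability (k : ℕ) : DistLanguage := fun _ => {X | ¬ X.graph.Colorable k}

/-! ### Synchronous distributed algorithms -/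

/-- The messages a node receives in one round, indexed by the identifier of the sender;
`none` for the nodes that are not neighbours. -/
abbrev Inbox (n b : ℕ) : Type := Fin n → Option (BitString b)

/-- A distributed algorithm with `b`-bit messages, executed by every node. A node starts in a local
state of type `σ`; the message it sends to the neighbour with a given identifier depends on its
state and on everything it received in the previous rounds, and so does its output. Local
computation is unrestricted. -/
structure DistAlgorithm (n b : ℕ) (σ ω : Type) where
  send : σ → List (Inbox n b) → Fin n → BitString b
  output : σ → List (Inbox n b) → ω

open Classical in
/-- The messages received by each node in the first `t` synchronous rounds. -/
def DistAlgorithm.received {n b : ℕ} {σ ω : Type} (A : DistAlgorithm n b σ ω)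
    (G : SimpleGraph (Fin n)) (init : Fin n → σ) : ℕ → Fin n → List (Inbox n b)
  | 0 => fun _ => []
  | t + 1 => fun v =>
      A.received G init t v ++
        [fun u => if G.Adj u v then some (A.send (init u) (A.received G init t u) v) else none]

/-- The output of node `v` after `c` rounds. -/
def DistAlgorithm.run {n b : ℕ} {σ ω : Type} (A : DistAlgorithm n b σ ω)
    (G : SimpleGraph (Fin n)) (init : Fin n → σ) (c : ℕ) (v : Fin n) : ω :=
  A.output (init v) (A.received G init c v)

/-! ### Distributed interactive proofs -/

/-- The distributed verifier. Every node draws its private coins uniformly and independently of the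
other nodes. In the interaction with the prover, each message of a node is a function of its input,
its coins and the messages it has exchanged with the prover so far. Afterwards the network runs the
verification algorithm, whose local states consist of input, coins and conversation with the
prover, and whose output is the decision of the node (`true` means accept). -/
structure DistVerifier (n l b : ℕ) where
  Coin : Type
  [fintypeCoin : Fintype Coin]
  [nonemptyCoin : Nonempty Coin]
  message : LocalInput n → Coin → List (BitString l) → BitString l
  verification : DistAlgorithm n b (LocalInput n × Coin × List (BitString l)) Bool

attribute [instance] DistVerifier.fintypeCoin DistVerifier.nonemptyCoin

/-- A prover (for one network, which it may depend on): a randomized strategy that, from the messages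
exchanged with all nodes so far, computes the next message for every node. -/
structure DistProver (n l : ℕ) where
  Coin : Type
  [fintypeCoin : Fintype Coin]
  [nonemptyCoin : Nonempty Coin]
  message : Coin → List (Fin n → BitString l) → Fin n → BitString l

attribute [instance] DistProver.fintypeCoin DistProver.nonemptyCoin

section Execution

variable {n l b : ℕ} (V : DistVerifier n l b) (P : DistProver n l) (X : Network n)

/-- The coins of all nodes and of the prover. -/
abbrev JointCoins : Type := (Fin n → V.Coin) × P.Coin

/-- The first `i` messages between each node and the prover in an interaction of `r` rounds.
The rounds of the prover and of the nodes alternate, and the last round is the prover's. -/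
def conversation (r : ℕ) (ρ : JointCoins V P) : ℕ → List (Fin n → BitString l)
  | 0 => []
  | i + 1 =>
      conversation r ρ i ++
        [if Odd (r - i) then P.message ρ.2 (conversation r ρ i)
         else fun v => V.message (X.localInput v) (ρ.1 v) ((conversation r ρ i).map (· v))]

/-- The state of a node when the verification algorithm starts. -/
def stateAfterInteraction (r : ℕ) (ρ : JointCoins V P) (v : Fin n) :
    LocalInput n × V.Coin × List (BitString l) :=
  (X.localInput v, ρ.1 v, (conversation V P X r ρ r).map (· v))

/-- The probability that all nodes accept, for `r` rounds of interaction and `c` rounds of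
verification. -/
def acceptProb (r c : ℕ) : ℝ :=
  ((PMF.uniformOfFintype (JointCoins V P)).toOuterMeasure
    {ρ | ∀ v, V.verification.run X.graph (stateAfterInteraction V P X r ρ) c v = true}).toReal

/-- The view of a node: its coins, its conversation with the prover, and all messages received from
its neighbours during verification. -/
abbrev NodeView : Type := V.Coin × List (BitString l) × List (Inbox n b)

/-- The distribution of the view of node `v`. -/
def viewDist (r c : ℕ) (v : Fin n) : PMF (NodeView V) :=
  (PMF.uniformOfFintype (JointCoins V P)).map fun ρ =>
    (ρ.1 v, (conversation V P X r ρ r).map (· v),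
      V.verification.received X.graph (stateAfterInteraction V P X r ρ) c v)

/-- A simulator: a randomized distributed algorithm, run by the network without any prover, in which
every node outputs a simulated view. -/
structure Simulator where
  Coin : Type
  [fintypeCoin : Fintype Coin]
  [nonemptyCoin : Nonempty Coin]
  algorithm : DistAlgorithm n b (LocalInput n × Coin) (NodeView V)

attribute [instance] Simulator.fintypeCoin Simulator.nonemptyCoin

/-- The distribution of the output of node `v` after `c` rounds of the simulator. -/
def simDist {V : DistVerifier n l b} (S : Simulator V) (X : Network n) (c : ℕ) (v : Fin n) :
    PMF (NodeView V) :=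
  (PMF.uniformOfFintype (Fin n → S.Coin)).map fun ρ =>
    S.algorithm.run X.graph (fun u => (X.localInput u, ρ u)) c v

end Execution

/-- Total variation distance of two discrete distributions. -/
def tvDist {α : Type} (p q : PMF α) : ℝ := (1 / 2) * ∑' x, |(p x).toReal - (q x).toReal|

/-- The verifiers `V n` with the honest provers `P n X` form a distributed interactive proof for `L`
with `r n` rounds of interaction and `c n` rounds of verification on `n`-node networks. -/
def IsDistInteractiveProof (r c l b : ℕ → ℕ) (V : (n : ℕ) → DistVerifier n (l n) (b n))
    (P : (n : ℕ) → Network n → DistProver n (l n)) (L : DistLanguage) : Prop :=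
  (∀ n, ∀ X ∈ L n, 2 / 3 ≤ acceptProb (V n) (P n X) X (r n) (c n)) ∧
  (∀ n, ∀ X ∉ L n, ∀ P' : DistProver n (l n), acceptProb (V n) P' X (r n) (c n) ≤ 1 / 3)

/-- On the networks in `L`, for every node, the simulated view and the view in the interaction with
the honest prover are statistically indistinguishable: their distance is smaller than every inverse
polynomial in the number of nodes. -/
def IsStatZeroKnowledge (r c l b : ℕ → ℕ) (V : (n : ℕ) → DistVerifier n (l n) (b n))
    (P : (n : ℕ) → Network n → DistProver n (l n)) (S : (n : ℕ) → Simulator (V n))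
    (L : DistLanguage) : Prop :=
  ∀ d : ℕ, ∀ᶠ n in atTop, ∀ X ∈ L n, ∀ v : Fin n,
    tvDist (simDist (S n) X (c n) v) (viewDist (V n) (P n X) X (r n) (c n) v) ≤ 1 / (n : ℝ) ^ d

/-- The class `dStatZK[r, l, C[c, b]]`: the distributed languages that have a statistical
zero-knowledge distributed interactive proof with `r` rounds of interaction and `l`-bit messages
between each node and the prover, whose verification algorithm and simulator both run in `c`
synchronous rounds with `b`-bit messages between neighbours. -/
def dStatZK (r l c b : ℕ → ℕ) : Set DistLanguage :=
  {L | ∃ (V : (n : ℕ) → DistVerifier n (l n) (b n))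
        (P : (n : ℕ) → Network n → DistProver n (l n)) (S : (n : ℕ) → Simulator (V n)),
      IsDistInteractiveProof r c l b V P L ∧ IsStatZeroKnowledge r c l b V P S L}

/-- `q(n) = n ^ ω(1)`. -/
def IsSuperpolynomial (q : ℕ → ℕ) : Prop := ∀ d : ℕ, ∀ᶠ n in atTop, n ^ d ≤ q n

end

/-!
The graph polynomial, the product of `x v - x u` over all edges, is nonzero at `x` exactly if `x` is
a proper colouring, so `G` is not `k`-colourable if and only if the polynomial vanishes at all
colourings by a fixed set of `k` field elements. Every node draws a random `z v`, and the sumcheck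
protocol convinces the nodes that the sum of the values of the polynomial at all these colourings,
where the colour with index `a` at `v` has weight `z v ^ a`, is zero; if some value is nonzero, then
so is the sum, except with small probability. The degree in each variable is less than `n`, so `n`
steps and a field of polynomial size suffice.

The coefficients of the sumcheck polynomials are additively shared among the nodes, and the checks
of all steps are combined, by powers of a late challenge, into one linear test of the shares. The
test is evaluated along the spanning tree, as is the value of the graph polynomial at the random
point.

For zero knowledge, every node multiplies the polynomial by a random nonzero factor, so that the
partial products over subtrees are uniform, and the prover masks the partial sums. The evaluation
points of different nodes are distinct, so that no product vanishes. The coins of an honest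
execution are then in bijection with coins from which a node that knows its children computes the
same view by itself, so that the simulation is perfect.
-/

noncomputable section

/-! ### The spanning tree of a network -/

namespace Network

variable {n : ℕ} (X : Network n)

include X in
theorem pos : 0 < n := X.connected.nonempty.some.pos

/-- The root of the spanning tree. -/
def root : Fin n := ⟨0, X.pos⟩

theorem eq_root_iff {v : Fin n} : v = X.root ↔ v.val = 0 := by simp [root, Fin.ext_iff]

theorem parent_root_eq : X.parent X.root = X.root := X.parent_root _ rfl

theorem eq_of_adj_imp_eq {α : Sort*} {φ : Fin n → α} (hφ : ∀ u v, X.graph.Adj u v → φ u = φ v)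
    (u v : Fin n) : φ u = φ v := by
  obtain ⟨w⟩ := X.connected.preconnected u v
  induction w with
  | nil => rfl
  | cons hadj _ ih => exact (hφ _ _ hadj).trans ih

open Classical in
/-- The children of a node in the spanning tree. The root is its own parent, but not its own
child. -/
def children (v : Fin n) : Finset (Fin n) := {u | X.graph.Adj v u ∧ X.parent u = v}

theorem mem_children {u v : Fin n} : u ∈ X.children v ↔ u ≠ X.root ∧ X.parent u = v := by
  simp only [children, Finset.mem_filter, Finset.mem_univ, true_and]
  refine and_congr_left ?_
  rintro rfl
  constructor
  · rintro hadj rfl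
    exact hadj.ne X.parent_root_eq
  · exact fun hu => (X.parent_adj u (mt X.eq_root_iff.2 hu)).symm

open Classical in
/-- The nodes whose path to the root passes through `v`. -/
def subtree (v : Fin n) : Finset (Fin n) := {u | ∃ m : ℕ, X.parent^[m] u = v}

theorem mem_subtree {u v : Fin n} : u ∈ X.subtree v ↔ ∃ m : ℕ, X.parent^[m] u = v := by
  simp [subtree]

theorem parent_iterate_root (m : ℕ) : X.parent^[m] X.root = X.root :=
  Function.iterate_fixed X.parent_root_eq m

theorem eq_root_of_parent_iterate_succ {v : Fin n} {m : ℕ} (h : X.parent^[m + 1] v = v) :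
    v = X.root := by
  obtain ⟨d, hd⟩ := X.parent_reaches_root v
  calc v = X.parent^[(m + 1) * d] v := by
        rw [Function.iterate_mul, Function.iterate_fixed h]
    _ = X.parent^[m * d] (X.parent^[d] v) := by
        rw [← Function.iterate_add_apply, Nat.succ_mul]
    _ = X.root := by rw [X.eq_root_iff.2 hd, parent_iterate_root]

@[simp]
theorem subtree_root : X.subtree X.root = Finset.univ := by
  ext u
  obtain ⟨m, hm⟩ := X.parent_reaches_root u
  simpa [mem_subtree] using ⟨m, X.eq_root_iff.2 hm⟩

theorem subtree_eq_insert (v : Fin n) :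
    X.subtree v = insert v ((X.children v).biUnion X.subtree) := by
  ext u
  simp only [mem_subtree, Finset.mem_insert, Finset.mem_biUnion, mem_children]
  constructor
  · rintro ⟨m, hm⟩
    induction m with
    | zero => exact .inl hm
    | succ m ih =>
      rw [Function.iterate_succ_apply'] at hm
      by_cases hroot : X.parent^[m] u = X.root
      · rw [hroot, parent_root_eq] at hm
        exact ih (hroot.trans hm)
      · exact .inr ⟨_, ⟨hroot, hm⟩, m, rfl⟩
  · rintro (rfl | ⟨c, ⟨_, rfl⟩, m, rfl⟩)
    · exact ⟨0, rfl⟩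
    · exact ⟨m + 1, Function.iterate_succ_apply' _ _ _⟩

theorem notMem_biUnion_children_subtree (v : Fin n) : v ∉ (X.children v).biUnion X.subtree := by
  simp only [mem_subtree, Finset.mem_biUnion, mem_children, not_exists, not_and]
  rintro c ⟨hc, rfl⟩ m hm
  exact hc (X.eq_root_of_parent_iterate_succ hm)

/-- Two children of `v` on the path from `u` to the root would put `v` on a cycle. -/
theorem eq_of_parent_iterate_mem_children {u v : Fin n} {a d : ℕ}
    (ha : X.parent^[a] u ∈ X.children v) (had : X.parent^[a + d] u ∈ X.children v) : d = 0 := by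
  rw [mem_children, ← Function.iterate_succ_apply' X.parent] at ha had
  rcases d with - | d
  · rfl
  · have hv : v = X.root := X.eq_root_of_parent_iterate_succ (m := d) <| by
      rw [← ha.2, ← Function.iterate_add_apply, ha.2, ← had.2]
      congr 2
      lia
    refine absurd ?_ had.1
    rw [show a + (d + 1) = d + (a + 1) by lia, Function.iterate_add_apply, ha.2, hv,
      parent_iterate_root]

theorem pairwiseDisjoint_subtree_children (v : Fin n) :
    (X.children v : Set (Fin n)).PairwiseDisjoint X.subtree := by
  intro c hc c' hc' hne
  refine Finset.disjoint_left.2 fun u hu hu' => hne ?_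
  obtain ⟨a, rfl⟩ := X.mem_subtree.1 hu
  obtain ⟨a', rfl⟩ := X.mem_subtree.1 hu'
  rcases le_total a a' with h | h <;> obtain ⟨d, rfl⟩ := Nat.exists_eq_add_of_le h
  · rw [X.eq_of_parent_iterate_mem_children hc hc', add_zero]
  · rw [X.eq_of_parent_iterate_mem_children hc' hc, add_zero]

@[to_additive]
theorem prod_subtree {M : Type*} [CommMonoid M] (g : Fin n → M) (v : Fin n) :
    ∏ u ∈ X.subtree v, g u = g v * ∏ c ∈ X.children v, ∏ u ∈ X.subtree c, g u := by
  rw [subtree_eq_insert, Finset.prod_insert (X.notMem_biUnion_children_subtree v),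
    Finset.prod_biUnion (X.pairwiseDisjoint_subtree_children v)]

@[to_additive]
theorem mul_prod_prod_children {M : Type*} [CommMonoid M] (g : Fin n → M) :
    g X.root * ∏ v, ∏ c ∈ X.children v, g c = ∏ v, g v := by
  rw [← Finset.mul_prod_erase Finset.univ g (Finset.mem_univ X.root),
    ← Finset.prod_fiberwise (Finset.univ.erase X.root) X.parent g]
  congr 1
  refine Finset.prod_congr rfl fun v _ => Finset.prod_congr ?_ fun _ _ => rfl
  ext c
  simp [mem_children]

end Network

namespace NonColorability

/-! ### Resampling one coordinate -/

section Resampling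

/-- A coordinate of `Ω` with values in `Y` that can be read and overwritten independently of
everything else. For a uniformly random element of `Ω` it is uniform and independent of the
remaining coordinates; the laws say so without splitting `Ω` as a product. -/
structure Coordinate (Ω Y : Type*) where
  get : Ω → Y
  set : Ω → Y → Ω
  get_set : ∀ ω y, get (set ω y) = y
  set_get : ∀ ω, set ω (get ω) = ω
  set_set : ∀ ω y y', set (set ω y) y' = set ω y'

namespace Coordinate

variable {Ω Y F : Type*} [Fintype Ω] [Fintype Y] (c : Coordinate Ω Y) {B : Set Ω} {d : ℕ}

include c

theorem card_mul_card_le (hB : ∀ ω, {y | c.set ω y ∈ B}.ncard ≤ d) :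
    B.ncard * Fintype.card Y ≤ d * Fintype.card Ω := by
  classical
  let swap : Ω × Y ≃ Ω × Y :=
    { toFun := fun p => (c.set p.1 p.2, c.get p.1)
      invFun := fun p => (c.set p.1 p.2, c.get p.1)
      left_inv := fun p => by simp [c.get_set, c.set_get, c.set_set]
      right_inv := fun p => by simp [c.get_set, c.set_get, c.set_set] }
  simp only [Set.ncard_eq_toFinset_card', Set.toFinset_ofPred] at hB ⊢
  calc B.toFinset.card * Fintype.card Y
      = ∑ p : Ω × Y, if p.1 ∈ B then 1 else 0 := by
        rw [Fintype.sum_prod_type, Finset.sum_comm]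
        simp [Finset.sum_boole, mul_comm, Set.toFinset]
    _ = ∑ p : Ω × Y, if c.set p.1 p.2 ∈ B then 1 else 0 :=
        (swap.sum_comp fun p => if p.1 ∈ B then 1 else 0).symm
    _ = ∑ ω : Ω, ({y | c.set ω y ∈ B} : Finset Y).card := by
        rw [Fintype.sum_prod_type]
        simp only [Finset.sum_boole, Nat.cast_id]
    _ ≤ ∑ _ω : Ω, d := Finset.sum_le_sum fun ω _ => hB ω
    _ = d * Fintype.card Ω := by simp [mul_comm]

theorem toOuterMeasure_uniformOfFintype_le [Nonempty Ω]
    (hB : ∀ ω, {y | c.set ω y ∈ B}.ncard ≤ d) :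
    (PMF.uniformOfFintype Ω).toOuterMeasure B ≤ d / Fintype.card Y := by
  classical
  have : Nonempty Y := .map c.get ‹_›
  rw [PMF.toOuterMeasure_uniformOfFintype_apply, ← Nat.card_eq_fintype_card,
    Nat.card_coe_set_eq]
  refine ENNReal.div_le_of_le_mul ?_
  rw [← ENNReal.mul_div_right_comm, ENNReal.le_div_iff_mul_le (by simp) (by simp)]
  exact_mod_cast c.card_mul_card_le hB

theorem toOuterMeasure_uniformOfFintype_le_of_isRoot [Nonempty Ω] [CommRing F] [IsDomain F]
    {φ : Y → F} (hφ : φ.Injective)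
    (hB : ∀ ω ∈ B, ∃ p : Polynomial F, p ≠ 0 ∧ p.natDegree ≤ d ∧
      ∀ y, c.set ω y ∈ B → p.IsRoot (φ y)) :
    (PMF.uniformOfFintype Ω).toOuterMeasure B ≤ d / Fintype.card Y := by
  classical
  refine c.toOuterMeasure_uniformOfFintype_le fun ω => ?_
  rcases Set.eq_empty_or_nonempty {y | c.set ω y ∈ B} with hempty | ⟨y₀, hy₀⟩
  · simp [hempty]
  · obtain ⟨p, hp, hdeg, hroot⟩ := hB _ hy₀
    calc {y | c.set ω y ∈ B}.ncard = (φ '' {y | c.set ω y ∈ B}).ncard :=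
          (Set.ncard_image_of_injective _ hφ).symm
      _ ≤ (p.roots.toFinset : Set F).ncard := by
          refine Set.ncard_le_ncard ?_ (Finset.finite_toSet _)
          rintro _ ⟨y, hy, rfl⟩
          simpa [hp] using hroot y (by rwa [c.set_set])
      _ ≤ p.natDegree := by
          rw [Set.ncard_coe_finset]
          exact (Multiset.toFinset_card_le _).trans p.card_roots'
      _ ≤ d := hdeg

/-- A coordinate of the coin of node `v`, as a coordinate of the coins of all nodes and the
prover. -/
def atNode {ι A Ω' : Type*} [DecidableEq ι] (c : Coordinate A Y) (v : ι) :
    Coordinate ((ι → A) × Ω') Y where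
  get ω := c.get (ω.1 v)
  set ω y := (Function.update ω.1 v (c.set (ω.1 v) y), ω.2)
  get_set ω y := by simp [c.get_set]
  set_get ω := by simp [c.set_get]
  set_set ω y y' := by simp [c.set_set]

end Coordinate

end Resampling

/-! ### The edge product -/

section EdgeProduct

variable {ι R S : Type*} [Fintype ι] [LinearOrder ι] [CommRing R] [CommRing S]

open Classical in
/-- The part of the edge product that a vertex `v` with set of neighbours `N` is responsible for:
each edge is assigned to its larger endpoint. -/
def vertexFactor (N : ι → Prop) (x : ι → R) (v : ι) : R :=
  ∏ u with N u ∧ u < v, (x v - x u)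

/-- The graph polynomial: the product of `x v - x u` over all edges `uv` with `u < v`, which is
nonzero exactly if `x` is a proper colouring. -/
def edgeProduct (G : SimpleGraph ι) (x : ι → R) : R :=
  ∏ v, vertexFactor (G.Adj v) x v

theorem vertexFactor_ne_zero [IsDomain R] (N : ι → Prop) {x : ι → R} (hx : x.Injective) (v : ι) :
    vertexFactor N x v ≠ 0 := by
  simp only [vertexFactor, Finset.prod_ne_zero_iff, Finset.mem_filter, sub_ne_zero]
  exact fun u hu => hx.ne hu.2.2.ne'

theorem edgeProduct_ne_zero_iff [IsDomain R] (G : SimpleGraph ι) (x : ι → R) :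
    edgeProduct G x ≠ 0 ↔ ∀ u v, G.Adj u v → x u ≠ x v := by
  simp only [edgeProduct, vertexFactor, Finset.prod_ne_zero_iff, Finset.mem_univ, true_imp_iff,
    Finset.mem_filter, true_and, sub_ne_zero]
  refine ⟨fun h u v huv => ?_, fun h v u huv => h v u huv.1⟩
  rcases huv.ne.lt_or_gt with hlt | hlt
  · exact (h v u ⟨huv.symm, hlt⟩).symm
  · exact h u v ⟨huv, hlt⟩

theorem map_edgeProduct (φ : R →+* S) (G : SimpleGraph ι) (x : ι → R) :
    φ (edgeProduct G x) = edgeProduct G (φ ∘ x) := by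
  simp [edgeProduct, vertexFactor]

/-- The pairs `u < v` that contain `i` number `|ι| - 1`, and the remaining factors are constant. -/
theorem natDegree_edgeProduct_lt (G : SimpleGraph ι) (y : ι → Polynomial R) (i : ι)
    (hy : ∀ v, (y v).natDegree ≤ if v = i then 1 else 0) :
    (edgeProduct G y).natDegree < Fintype.card ι := by
  classical
  have factor_le : ∀ v u,
      (y v - y u).natDegree ≤ (if v = i then 1 else 0) + if u = i then 1 else 0 :=
    fun v u => (Polynomial.natDegree_sub_le _ _).trans
      (max_le ((hy v).trans le_self_add) ((hy u).trans le_add_self))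
  have vertex_le : ∀ v, (vertexFactor (G.Adj v) y v).natDegree ≤
      ∑ u with u < v, ((if v = i then 1 else 0) + if u = i then 1 else 0) := fun v =>
    (Polynomial.natDegree_prod_le _ _).trans <|
      (Finset.sum_le_sum fun u _ => factor_le v u).trans <|
        Finset.sum_le_sum_of_subset (Finset.monotone_filter_right _ fun u _ hu => hu.2)
  calc (edgeProduct G y).natDegree
      ≤ ∑ v, ∑ u with u < v, ((if v = i then 1 else 0) + if u = i then 1 else 0) :=
        (Polynomial.natDegree_prod_le _ _).trans (Finset.sum_le_sum fun v _ => vertex_le v)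
    _ = ({u | u < i} : Finset ι).card + ({v | i < v} : Finset ι).card := by
        simp only [Finset.sum_add_distrib, Finset.sum_const, Finset.sum_ite_eq', smul_eq_mul,
          Finset.mem_filter, Finset.mem_univ, true_and, mul_ite, mul_one, mul_zero,
          Finset.sum_boole, Nat.cast_id, if_true]
    _ = (Finset.univ.erase i).card := by
        rw [← Finset.card_union_of_disjoint
          (Finset.disjoint_filter.2 fun u _ h h' => lt_asymm h h')]
        congr 1
        ext u
        simp [lt_or_lt_iff_ne]
    _ < Fintype.card ι := Finset.card_erase_lt_of_mem (Finset.mem_univ i)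

end EdgeProduct

/-! ### Partial sums over a grid -/

section PartialSum

variable {R A M : Type*} [CommSemiring R] [AddCommMonoid M] [Module R M] {n k : ℕ}

/-- The sums of the sumcheck protocol: `f` summed over all values `grid a` of the coordinates
`i ≥ j`, where coordinate `i` contributes the weight `z i ^ a`. -/
def partialSum (z : Fin n → R) (grid : Fin k → A) (f : (Fin n → A) → M) (j : Fin (n + 1)) :
    (Fin n → A) → M :=
  Fin.reverseInduction f
    (fun j rest x => ∑ a : Fin k, z j ^ (a : ℕ) • rest (Function.update x j (grid a))) j

variable (z : Fin n → R) (grid : Fin k → A) (f : (Fin n → A) → M)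

@[simp]
theorem partialSum_last : partialSum z grid f (Fin.last n) = f :=
  Fin.reverseInduction_last ..

theorem partialSum_castSucc (j : Fin n) (x : Fin n → A) :
    partialSum z grid f j.castSucc x =
      ∑ a : Fin k, z j ^ (a : ℕ) • partialSum z grid f j.succ (Function.update x j (grid a)) := by
  simp [partialSum]

variable {z grid f}

theorem partialSum_congr {z' : Fin n → R} {j : Fin (n + 1)} {x x' : Fin n → A}
    (hz : ∀ i : Fin n, j ≤ i.castSucc → z i = z' i)
    (hx : ∀ i : Fin n, i.castSucc < j → x i = x' i) :
    partialSum z grid f j x = partialSum z' grid f j x' := by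
  induction j using Fin.reverseInduction generalizing x x' with
  | last => rw [partialSum_last, partialSum_last, funext fun i => hx i i.castSucc_lt_last]
  | cast j ih =>
    simp only [partialSum_castSucc, hz j le_rfl]
    refine Finset.sum_congr rfl fun a _ => congrArg _ (ih ?_ ?_)
    · exact fun i hi => hz i (j.castSucc_le_succ.trans hi)
    · intro i hi
      rcases eq_or_ne i j with rfl | hij
      · simp
      · simpa [hij] using hx i (by grind)

/-- With `N = ⊥` this says that partial sums of a function vanishing on the grid vanish; with the
polynomials of bounded degree as `N` it bounds the degree of a partial sum. -/
theorem partialSum_mem {N : Submodule R M} {j : Fin (n + 1)} {x : Fin n → A}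
    (hf : ∀ y, (∀ i : Fin n, i.castSucc < j → y i = x i) →
      (∀ i : Fin n, j ≤ i.castSucc → y i ∈ Set.range grid) → f y ∈ N) :
    partialSum z grid f j x ∈ N := by
  induction j using Fin.reverseInduction generalizing x with
  | last =>
    rw [partialSum_last]
    exact hf x (fun _ _ => rfl) fun i hi => absurd hi i.castSucc_lt_last.not_ge
  | cast j ih =>
    rw [partialSum_castSucc]
    refine N.sum_mem fun a _ => N.smul_mem _ (ih fun y hlt hge => hf y ?_ ?_)
    · intro i hi
      rw [hlt i (by grind), Function.update_of_ne (by grind)]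
    · intro i hi
      rcases eq_or_ne i j with rfl | hij
      · exact ⟨a, by simp [hlt i]⟩
      · exact hge i (by grind)

theorem map_partialSum {A' M' : Type*} [AddCommMonoid M'] [Module R M'] (φ : M →ₗ[R] M')
    (ψ : A → A') {f' : (Fin n → A') → M'} (hf : ∀ y, φ (f y) = f' (ψ ∘ y)) (j : Fin (n + 1))
    (x : Fin n → A) :
    φ (partialSum z grid f j x) = partialSum z (ψ ∘ grid) f' j (ψ ∘ x) := by
  induction j using Fin.reverseInduction generalizing x with
  | last => simp [hf]
  | cast j ih => simp [partialSum_castSucc, ih, Function.comp_update]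

end PartialSum

/-! ### Conversations -/

section Conversation

variable {n l b : ℕ} (V : DistVerifier n l b) (P : DistProver n l) (X : Network n) (r : ℕ)

/-- The messages of round `j`, counted from zero. -/
def messageAt (ρ : JointCoins V P) (j : ℕ) : Fin n → BitString l :=
  if Odd (r - j) then P.message ρ.2 (conversation V P X r ρ j)
  else fun v => V.message (X.localInput v) (ρ.1 v) ((conversation V P X r ρ j).map (· v))

theorem conversation_eq_map (ρ : JointCoins V P) (i : ℕ) :
    conversation V P X r ρ i = (List.range i).map (messageAt V P X r ρ) := by
  induction i with
  | zero => rfl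
  | succ i ih => rw [List.range_succ, List.map_append, ← ih]; rfl

theorem length_conversation (ρ : JointCoins V P) (i : ℕ) :
    (conversation V P X r ρ i).length = i := by simp [conversation_eq_map]

theorem getD_conversation (ρ : JointCoins V P) {i j : ℕ} (h : j < i) (d : Fin n → BitString l) :
    (conversation V P X r ρ i).getD j d = messageAt V P X r ρ j := by
  simp [conversation_eq_map, h]

theorem conversation_congr {ρ ρ' : JointCoins V P} (hP : ρ.2 = ρ'.2) (i : ℕ)
    (hV : ∀ v L, L.length < i →
      V.message (X.localInput v) (ρ.1 v) L = V.message (X.localInput v) (ρ'.1 v) L) :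
    conversation V P X r ρ i = conversation V P X r ρ' i := by
  induction i with
  | zero => rfl
  | succ i ih =>
    have ih' := ih fun v L hL => hV v L (by lia)
    simp only [conversation, ih', hP]
    congr 2
    split_ifs
    · rfl
    · funext v
      exact hV v _ (by rw [List.length_map, length_conversation]; lia)

theorem messageAt_congr {ρ ρ' : JointCoins V P} (hP : ρ.2 = ρ'.2) {j : ℕ}
    (hV : ∀ v L, L.length ≤ j →
      V.message (X.localInput v) (ρ.1 v) L = V.message (X.localInput v) (ρ'.1 v) L) :
    messageAt V P X r ρ j = messageAt V P X r ρ' j := by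
  rw [← getD_conversation V P X r ρ j.lt_succ_self default,
    conversation_congr V P X r hP _ fun v L hL => hV v L (Nat.lt_succ_iff.1 hL),
    getD_conversation V P X r ρ' j.lt_succ_self default]

end Conversation

/-! ### The protocol -/

/-- The private coins of a node: the base of the weights of its colours in the sum over all
colourings, a multiplier that hides the products of subtrees, the index of its evaluation point,
and a challenge, which matters only for the root. -/
@[ext]
structure NodeCoin (F : Type) [Field F] (m : ℕ) where
  weight : F
  mult : Fˣ
  index : Fin m
  challenge : F

/-- The coins that a node reveals in a round; those not revealed in this round are zero. -/
structure NodeMessage (F : Type) where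
  weight : F
  mult : F
  point : F
  challenge : F

/-- What the prover sends to a node in a round; components that are not used in this round are
zero. -/
structure ProverMessage (F : Type) where
  shareLeft : F
  shareRight : F
  weight : F
  point : F
  mask : F
  product : F
  total : F
  challenge : F

/-- The coins that every node learns in the end: weight bases, evaluation points and challenge. -/
@[ext]
structure PublicCoins (F : Type) (n : ℕ) where
  weight : Fin n → F
  point : Fin n → F
  challenge : F

/-- What a node is told by the prover. The coefficients of the `j`-th sumcheck polynomial are
additively shared: the node `v` gets one share of the coefficient `v` and one share of the
coefficient `finRotate n v`. -/
structure Transcript (F : Type) (n : ℕ) where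
  shareLeft : Fin n → F
  shareRight : Fin n → F
  coins : PublicCoins F n
  mask : F
  product : F
  total : F

/-- A message between neighbours: the coins as announced by the prover, and the product and the
total of the subtree of the sender. -/
structure EdgeMessage (F : Type) (n : ℕ) where
  coins : PublicCoins F n
  product : F
  total : F

section Instances

variable {F : Type} [Field F] {n m : ℕ}

instance [Finite F] : Finite (NodeCoin F m) :=
  .of_injective (fun c => (c.weight, c.mult, c.index, c.challenge)) fun c c' h => by
    cases c; cases c'; simp_all

instance [Finite F] : Fintype (NodeCoin F m) := .ofFinite _

instance [NeZero m] : Nonempty (NodeCoin F m) := ⟨⟨0, 1, 0, 0⟩⟩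

instance : Nonempty (NodeMessage F) := ⟨⟨0, 0, 0, 0⟩⟩

instance : Nonempty (ProverMessage F) := ⟨⟨0, 0, 0, 0, 0, 0, 0, 0⟩⟩

instance : Nonempty (EdgeMessage F n) := ⟨⟨⟨0, 0, 0⟩, 0, 0⟩⟩

end Instances

/-- The parameters of the protocol: the evaluation points of the nodes, the field elements that
represent colours, and the encodings of messages. -/
structure Setup (F : Type) (n m k l b : ℕ) where
  point : Fin n × Fin m ↪ F
  color : Fin k ↪ F
  nodeCode : NodeMessage F ↪ BitString l
  proverCode : ProverMessage F ↪ BitString l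
  edgeCode : EdgeMessage F n ↪ BitString b

namespace Transcript

variable {F : Type} {n : ℕ}

/-- The message by which the prover communicates its part of the transcript in its round `t`. -/
def message [Zero F] (T : Transcript F n) (t : ℕ) : ProverMessage F where
  shareLeft := Function.extend Fin.val T.shareLeft 0 t
  shareRight := Function.extend Fin.val T.shareRight 0 t
  weight := Function.extend Fin.val T.coins.weight 0 t
  point := Function.extend (fun i : Fin n => (i : ℕ) + 1) T.coins.point 0 t
  mask := T.mask
  product := if t = n + 1 then T.product else 0
  total := if t = n + 1 then T.total else 0
  challenge := if t = n + 1 then T.coins.challenge else 0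

/-- The transcript communicated by given messages of the prover. -/
def ofMessages (w : ℕ → ProverMessage F) : Transcript F n where
  shareLeft j := (w j).shareLeft
  shareRight j := (w j).shareRight
  coins :=
    { weight := fun v => (w v).weight
      point := fun v => (w (v + 1)).point
      challenge := (w (n + 1)).challenge }
  mask := (w 0).mask
  product := (w (n + 1)).product
  total := (w (n + 1)).total

theorem ofMessages_congr {w w' : ℕ → ProverMessage F} (h : ∀ t ≤ n + 1, w t = w' t) :
    (ofMessages w : Transcript F n) = ofMessages w' := by
  have hlt : ∀ j : Fin n, w j = w' j := fun j => h j (by lia)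
  have hsucc : ∀ j : Fin n, w (j + 1) = w' (j + 1) := fun j => h (j + 1) (by lia)
  simp only [ofMessages, hlt, hsucc, h 0 (by lia), h (n + 1) le_rfl]

theorem ofMessages_message [Zero F] (T : Transcript F n) : ofMessages T.message = T := by
  have hsucc : Function.Injective fun i : Fin n => (i : ℕ) + 1 :=
    (add_left_injective 1).comp Fin.val_injective
  simp only [ofMessages, message, Fin.val_injective.extend_apply, hsucc.extend_apply, if_true]

end Transcript

section Verifier

variable {F : Type} [Field F] {n k : ℕ}

/-- The linear functional that the global test applies to the `j`-th sumcheck polynomial: the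
challenge separates the claimed sum over the colours of `j` from the value at the point of `j`. -/
def roundTest (color : Fin k → F) (c : PublicCoins F n) (j : Fin n) : Polynomial F →ₗ[F] F :=
  c.challenge ^ ((j : ℕ) + 1) • ∑ a : Fin k, c.weight j ^ (a : ℕ) • Polynomial.leval (color a) -
    c.challenge ^ ((j : ℕ) + 2) • Polynomial.leval (c.point j)

/-- The summand of a node in the global linear test, up to the mask. -/
def contribution (color : Fin k → F) (T : Transcript F n) (v : Fin n) : F :=
  ∑ j, (T.shareLeft j * roundTest color T.coins j (.X ^ (v : ℕ)) +
    T.shareRight j * roundTest color T.coins j (.X ^ (finRotate n v : ℕ))) +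
  if v.val = 0 then T.coins.challenge ^ (n + 1) * T.product else 0

/-- What a node with parent `p` sends to its neighbour `v`. -/
def Transcript.edgeMessage (T : Transcript F n) (p v : Fin n) : EdgeMessage F n where
  coins := T.coins
  product := if p = v then T.product else 1
  total := if p = v then T.total else 0

open Classical in
/-- The messages that `v` receives during verification, decoded. -/
def inbox (X : Network n) (T : Fin n → Transcript F n) (v : Fin n) :
    Fin n → Option (EdgeMessage F n) :=
  fun u => if X.graph.Adj u v then some ((T u).edgeMessage (X.parent u) v) else none

theorem mem_inbox (X : Network n) (T : Fin n → Transcript F n) (v u : Fin n) (M : EdgeMessage F n) :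
    M ∈ inbox X T v u ↔ X.graph.Adj u v ∧ (T u).edgeMessage (X.parent u) v = M := by
  simp [inbox]

theorem isSome_inbox (X : Network n) (T : Fin n → Transcript F n) (v : Fin n) :
    (fun u => ((inbox X T v u).isSome : Prop)) = X.graph.Adj v := by
  funext u
  by_cases h : X.graph.Adj u v <;> simp [inbox, h, X.graph.adj_comm v u]

theorem prod_inbox (X : Network n) (T : Fin n → Transcript F n) (v : Fin n) :
    ∏ u, (inbox X T v u).elim 1 EdgeMessage.product = ∏ u ∈ X.children v, (T u).product := by
  rw [Network.children, Finset.prod_filter]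
  refine Finset.prod_congr rfl fun u _ => ?_
  by_cases h : X.graph.Adj u v <;>
    simp [inbox, h, X.graph.adj_comm v u, Transcript.edgeMessage]

theorem sum_inbox (X : Network n) (T : Fin n → Transcript F n) (v : Fin n) :
    ∑ u, (inbox X T v u).elim 0 EdgeMessage.total = ∑ u ∈ X.children v, (T u).total := by
  rw [Network.children, Finset.sum_filter]
  refine Finset.sum_congr rfl fun u _ => ?_
  by_cases h : X.graph.Adj u v <;>
    simp [inbox, h, X.graph.adj_comm v u, Transcript.edgeMessage]

end Verifier

namespace Setup

variable {F : Type} [Field F] {n m k l b : ℕ} (S : Setup F n m k l b)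

/-- The message of node `v` in its round `t`. -/
def nodeMessage (v : Fin n) (c : NodeCoin F m) (t : ℕ) : NodeMessage F where
  weight := c.weight
  mult := c.mult
  point := if t = v + 1 then S.point (v, c.index) else 0
  challenge := if t = n + 1 then c.challenge else 0

/-- The condition under which node `v` accepts, given its coins, its transcript and the messages of
its neighbours. -/
structure Accepts (v : Fin n) (c : NodeCoin F m) (T : Transcript F n)
    (I : Fin n → Option (EdgeMessage F n)) : Prop where
  coins_eq : ∀ u, ∀ M ∈ I u, M.coins = T.coins
  weight_eq : c.weight = T.coins.weight v
  point_eq : S.point (v, c.index) = T.coins.point v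
  challenge_eq : v.val = 0 → c.challenge = T.coins.challenge
  product_ne_zero : T.product ≠ 0
  product_eq : T.product = c.mult * vertexFactor (fun u => (I u).isSome) T.coins.point v *
    ∏ u, (I u).elim 1 EdgeMessage.product
  total_eq : T.total = T.mask + contribution S.color T v + ∑ u, (I u).elim 0 EdgeMessage.total
  total_root : v.val = 0 → T.total = 0

/-- The transcript of a node, read off its conversation with the prover. -/
def readTranscript (L : List (BitString l)) : Transcript F n :=
  .ofMessages fun t => Function.invFun S.proverCode (L.getD (2 * t + 1) default)

variable [Fintype F] [NeZero m]

open Classical in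
/-- The distributed verifier. -/
abbrev verifier : DistVerifier n l b where
  Coin := NodeCoin F m
  message I c L := S.nodeCode (S.nodeMessage I.id c (L.length / 2))
  verification :=
    { send := fun s _ v => S.edgeCode ((S.readTranscript s.2.2).edgeMessage s.1.parent v)
      output := fun s I => decide (S.Accepts s.1.id s.2.1 (S.readTranscript s.2.2)
        fun u => (I.headD (fun _ => none) u).map (Function.invFun S.edgeCode)) }

/-- The number of rounds of interaction. -/
abbrev rounds (n : ℕ) : ℕ := 2 * (n + 2)

variable (P : DistProver n l) (X : Network n)

/-- The decoded message to node `v` in round `t` of the prover. -/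
def proverMessage (ρ : JointCoins S.verifier P) (v : Fin n) (t : ℕ) : ProverMessage F :=
  Function.invFun S.proverCode (messageAt S.verifier P X (rounds n) ρ (2 * t + 1) v)

theorem proverMessage_congr {ρ ρ' : JointCoins S.verifier P} (hP : ρ.2 = ρ'.2) {t : ℕ}
    (h : ∀ u, ∀ s ≤ t, S.nodeMessage u (ρ.1 u) s = S.nodeMessage u (ρ'.1 u) s) (v : Fin n) :
    S.proverMessage P X ρ v t = S.proverMessage P X ρ' v t := by
  rw [proverMessage, proverMessage, messageAt_congr _ _ _ _ hP fun u L hL =>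
    congrArg S.nodeCode (h u _ (by lia))]

/-- The transcript of node `v` in an interaction with the prover `P`. -/
def transcript (ρ : JointCoins S.verifier P) (v : Fin n) : Transcript F n :=
  .ofMessages (S.proverMessage P X ρ v)

theorem readTranscript_conversation (ρ : JointCoins S.verifier P) (v : Fin n) :
    S.readTranscript ((conversation S.verifier P X (rounds n) ρ (rounds n)).map (· v)) =
      S.transcript P X ρ v := by
  refine Transcript.ofMessages_congr fun t ht => ?_
  have h : 2 * t + 1 < rounds n := by grind
  simp [conversation_eq_map, proverMessage, h]

theorem received_eq (ρ : JointCoins S.verifier P) (v : Fin n) :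
    S.verifier.verification.received X.graph
      (stateAfterInteraction S.verifier P X (rounds n) ρ) 1 v =
    [fun u => (inbox X (S.transcript P X ρ) v u).map S.edgeCode] := by
  simp only [DistAlgorithm.received, List.nil_append, List.cons.injEq, and_true]
  funext u
  simp only [inbox, apply_ite (Option.map S.edgeCode), Option.map_some, Option.map_none,
    ← readTranscript_conversation]
  rfl

theorem run_eq_true_iff (ρ : JointCoins S.verifier P) (v : Fin n) :
    S.verifier.verification.run X.graph
      (stateAfterInteraction S.verifier P X (rounds n) ρ) 1 v = true ↔
    S.Accepts v (ρ.1 v) (S.transcript P X ρ v) (inbox X (S.transcript P X ρ) v) := by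
  rw [DistAlgorithm.run, received_eq]
  have decode_encode : (fun u => ((inbox X (S.transcript P X ρ) v u).map S.edgeCode).map
      (Function.invFun S.edgeCode)) = inbox X (S.transcript P X ρ) v := by
    funext u
    rw [Option.map_map, Function.invFun_comp S.edgeCode.injective, Option.map_id, id]
  conv_rhs => rw [← decode_encode, ← readTranscript_conversation]
  exact @decide_eq_true_iff _ (Classical.propDecidable _)

end Setup

/-! ### The sumcheck polynomials -/

section Sumcheck

open Polynomial

variable {F : Type} [Field F] {n k : ℕ} (color : Fin k → F) (G : SimpleGraph (Fin n)) (s : F)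
  (c : PublicCoins F n)

/-- The polynomial of the `j`-th step of the sumcheck protocol for the weighted sum of
`s * edgeProduct G` over all colourings: the colours of the nodes before `j` are replaced by their
evaluation points, that of `j` by the variable, and the later ones are summed over. -/
def sumcheckPoly (j : Fin n) : F[X] :=
  s • partialSum c.weight (C ∘ color) (edgeProduct G) j.succ (Function.update (C ∘ c.point) j X)

/-- The value that is claimed after `i` steps of the sumcheck protocol. -/
def sumcheckValue (i : Fin (n + 1)) : F := s * partialSum c.weight color (edgeProduct G) i c.point

theorem eval_sumcheckPoly (j : Fin n) (x : F) :
    (sumcheckPoly color G s c j).eval x =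
      s * partialSum c.weight color (edgeProduct G) j.succ (Function.update c.point j x) := by
  have eval_C : eval x ∘ C = id := funext fun _ => Polynomial.eval_C
  have key := map_partialSum (z := c.weight) (grid := C ∘ color) (leval x) (eval x)
    (fun y => map_edgeProduct (evalRingHom x) G y) j.succ (Function.update (C ∘ c.point) j X)
  rw [Function.comp_update, ← Function.comp_assoc, ← Function.comp_assoc, eval_C, eval_X] at key
  rw [sumcheckPoly, eval_smul, smul_eq_mul]
  exact congrArg (s * ·) key

theorem sumcheckPoly_mem_degreeLT (j : Fin n) : sumcheckPoly color G s c j ∈ degreeLT F n := by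
  refine Submodule.smul_mem _ s (partialSum_mem fun y hlt hge => mem_degreeLT.2 ?_)
  have natDegree_lt := natDegree_edgeProduct_lt G y j fun v => by
    rcases lt_trichotomy v j with hv | rfl | hv
    · rw [hlt v (by grind), Function.update_of_ne hv.ne]
      simp
    · rw [hlt v (by grind), Function.update_self]
      simp
    · obtain ⟨a, ha⟩ := hge v (by grind)
      simp [← ha]
  rw [Fintype.card_fin] at natDegree_lt
  exact degree_le_natDegree.trans_lt (by exact_mod_cast natDegree_lt)

theorem eval_point_sumcheckPoly (j : Fin n) :
    (sumcheckPoly color G s c j).eval (c.point j) = sumcheckValue color G s c j.succ := by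
  rw [eval_sumcheckPoly, Function.update_eq_self, sumcheckValue]

theorem sum_eval_color_sumcheckPoly (j : Fin n) :
    ∑ a : Fin k, c.weight j ^ (a : ℕ) * (sumcheckPoly color G s c j).eval (color a) =
      sumcheckValue color G s c j.castSucc := by
  simp only [eval_sumcheckPoly, sumcheckValue, partialSum_castSucc, Finset.mul_sum, smul_eq_mul]
  exact Finset.sum_congr rfl fun a _ => mul_left_comm _ _ _

theorem sumcheckValue_last :
    sumcheckValue color G s c (Fin.last n) = s * edgeProduct G c.point := by
  rw [sumcheckValue, partialSum_last]

theorem sumcheckValue_zero (y : Fin n → F) :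
    sumcheckValue color G s c 0 = s * partialSum c.weight color (edgeProduct G) 0 y := by
  rw [sumcheckValue, partialSum_congr (fun _ _ => rfl) fun i hi => absurd hi (Fin.not_lt_zero _)]

end Sumcheck

/-! ### The global linear test -/

section LinearTest

open Polynomial

variable {F : Type} [Field F] {n k : ℕ}

theorem roundTest_apply (color : Fin k → F) (c : PublicCoins F n) (j : Fin n) (p : F[X]) :
    roundTest color c j p =
      c.challenge ^ ((j : ℕ) + 1) * ∑ a : Fin k, c.weight j ^ (a : ℕ) * p.eval (color a) -
        c.challenge ^ ((j : ℕ) + 2) * p.eval (c.point j) := by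
  simp [roundTest]

/-- The `j`-th sumcheck polynomial, reconstructed from the shares of its coefficients. -/
def sharedPoly (T : Fin n → Transcript F n) (j : Fin n) : F[X] :=
  ∑ v : Fin n, (monomial (v : ℕ) ((T v).shareLeft j) +
    monomial (finRotate n v : ℕ) ((T v).shareRight j))

theorem sharedPoly_mem_degreeLT (T : Fin n → Transcript F n) (j : Fin n) :
    sharedPoly T j ∈ degreeLT F n :=
  have monomial_mem (v : Fin n) (a : F) : monomial (v : ℕ) a ∈ degreeLT F n :=
    mem_degreeLT.2 ((degree_monomial_le _ _).trans_lt (by exact_mod_cast v.isLt))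
  Submodule.sum_mem _ fun _ _ => add_mem (monomial_mem _ _) (monomial_mem _ _)

theorem sum_contribution (color : Fin k → F) (X : Network n) {T : Fin n → Transcript F n}
    {c : PublicCoins F n} (hT : ∀ v, (T v).coins = c) :
    ∑ v, contribution color (T v) v =
      ∑ j, roundTest color c j (sharedPoly T j) + c.challenge ^ (n + 1) * (T X.root).product := by
  simp only [contribution, hT, Finset.sum_add_distrib, ← X.eq_root_iff, Finset.sum_ite_eq',
    Finset.mem_univ, if_true, sharedPoly, map_add, map_sum, ← smul_X_eq_monomial, map_smul,
    smul_eq_mul]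
  congr 2 <;> exact Finset.sum_comm

/-- The left-hand side of the global linear test as a polynomial in the challenge, where `A j` and
`B j` are the sum over the colours and the value at the evaluation point of the `j`-th sumcheck
polynomial. It vanishes if each `A j` agrees with the preceding value `B (j - 1)`, which for the
first step is zero, and the last value agrees with `f`. -/
def testPoly (a : F) (A B : Fin n → F) (f : F) : F[X] :=
  C a + ∑ i : Fin (n + 1),
    C ((Fin.snoc A f : Fin (n + 1) → F) i - (Fin.cons 0 B : Fin (n + 1) → F) i) * X ^ ((i : ℕ) + 1)

variable (a : F) (A B : Fin n → F) (f : F)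

theorem eval_testPoly (τ : F) :
    (testPoly a A B f).eval τ =
      a + (∑ j : Fin n, (τ ^ ((j : ℕ) + 1) * A j - τ ^ ((j : ℕ) + 2) * B j) +
        τ ^ (n + 1) * f) := by
  simp only [testPoly, eval_add, eval_C, eval_finsetSum, eval_mul, eval_pow, eval_X, sub_mul,
    Finset.sum_sub_distrib]
  rw [Fin.sum_univ_castSucc, Fin.sum_univ_succ (n := n)]
  simp only [Fin.snoc_castSucc, Fin.snoc_last, Fin.cons_zero, Fin.cons_succ, Fin.val_castSucc,
    Fin.val_last, Fin.val_succ, mul_comm (A _), mul_comm (B _)]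
  ring

theorem natDegree_testPoly_le : (testPoly a A B f).natDegree ≤ n + 1 := by
  refine natDegree_add_le_of_degree_le (by simp)
    (natDegree_sum_le_of_forall_le _ _ fun i _ => ?_)
  exact (natDegree_C_mul_X_pow_le _ _).trans (by lia)

variable {a A B f}

theorem testPoly_eq_zero_iff :
    testPoly a A B f = 0 ↔ a = 0 ∧ (Fin.snoc A f : Fin (n + 1) → F) = Fin.cons 0 B := by
  constructor
  · intro h
    constructor
    · simpa [testPoly] using congrArg (coeff · 0) h
    · funext i
      simpa [testPoly, -map_sub, coeff_C_succ, finsetSum_coeff, coeff_X_pow, Fin.val_inj,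
        sub_eq_zero] using congrArg (coeff · ((i : ℕ) + 1)) h
  · rintro ⟨rfl, h⟩
    simp [testPoly, h]

end LinearTest

/-! ### Soundness -/

section GlobalTest

open Polynomial

variable {F : Type} [Field F] {n k : ℕ} (color : Fin k → F) (G : SimpleGraph (Fin n)) (s : F)
  (c : PublicCoins F n) (T : Fin n → Transcript F n)

/-- The polynomial in the challenge that the shares and masks in the transcripts determine. It does
not depend on the challenge itself. -/
def globalTest : F[X] :=
  testPoly (∑ v, (T v).mask)
    (fun j => ∑ a : Fin k, c.weight j ^ (a : ℕ) * (sharedPoly T j).eval (color a))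
    (fun j => (sharedPoly T j).eval (c.point j)) (s * edgeProduct G c.point)

variable {color G s c T}

theorem eval_globalTest {X : Network n} (hT : ∀ v, (T v).coins = c)
    (hproduct : (T X.root).product = s * edgeProduct X.graph c.point) :
    (globalTest color X.graph s c T).eval c.challenge =
      ∑ v, (T v).mask + ∑ v, contribution color (T v) v := by
  simp only [sum_contribution color X hT, roundTest_apply, hproduct, globalTest, eval_testPoly]

theorem sumcheckValue_zero_of_globalTest_eq_zero (htest : globalTest color G s c T = 0)
    (hpoly : ∀ j,
      (sharedPoly T j).eval (c.point j) = (sumcheckPoly color G s c j).eval (c.point j) →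
        sharedPoly T j = sumcheckPoly color G s c j) :
    sumcheckValue color G s c 0 = 0 := by
  have hsnoc := congrFun (testPoly_eq_zero_iff.1 htest).2
  suffices h : ∀ i, sumcheckValue color G s c i =
      (Fin.cons 0 fun j => (sharedPoly T j).eval (c.point j) : Fin (n + 1) → F) i from h 0
  intro i
  induction i using Fin.reverseInduction with
  | last => rw [← hsnoc, Fin.snoc_last, sumcheckValue_last]
  | cast j ih =>
    rw [← eval_point_sumcheckPoly, Fin.cons_succ] at ih
    rw [← hsnoc, Fin.snoc_castSucc, hpoly j ih.symm, sum_eval_color_sumcheckPoly]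

end GlobalTest

namespace Setup

section Accepting

variable {F : Type} [Field F] {n m k l b : ℕ} (S : Setup F n m k l b) (X : Network n)

/-- The product of the multipliers of all nodes, by which the edge product is scaled. -/
def scale (ω : Fin n → NodeCoin F m) : F := ∏ v, ((ω v).mult : F)

/-- The coins that the nodes reveal, where the challenge is that of the root `r`. -/
def publicCoins (r : Fin n) (ω : Fin n → NodeCoin F m) : PublicCoins F n where
  weight v := (ω v).weight
  point v := S.point (v, (ω v).index)
  challenge := (ω r).challenge

variable {S X} {ω : Fin n → NodeCoin F m} {T : Fin n → Transcript F n}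

theorem scale_ne_zero (ω : Fin n → NodeCoin F m) : scale ω ≠ 0 :=
  Finset.prod_ne_zero_iff.2 fun v _ => (ω v).mult.ne_zero

theorem coins_eq_of_accepts (h : ∀ v, S.Accepts v (ω v) (T v) (inbox X T v)) (v : Fin n) :
    (T v).coins = S.publicCoins X.root ω := by
  have eq_coins : ∀ u v, (T u).coins = (T v).coins :=
    X.eq_of_adj_imp_eq fun u v huv => (h v).coins_eq u _ ((mem_inbox ..).2 ⟨huv, rfl⟩)
  refine PublicCoins.ext (funext fun u => ?_) (funext fun u => ?_) ?_
  · rw [eq_coins v u, ← (h u).weight_eq, publicCoins]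
  · rw [eq_coins v u, ← (h u).point_eq, publicCoins]
  · rw [eq_coins v X.root, ← (h X.root).challenge_eq rfl, publicCoins]

theorem product_root_eq_of_accepts (h : ∀ v, S.Accepts v (ω v) (T v) (inbox X T v)) :
    (T X.root).product = scale ω * edgeProduct X.graph (S.publicCoins X.root ω).point := by
  have prod_product : ∏ v, (T v).product =
      scale ω * edgeProduct X.graph (S.publicCoins X.root ω).point *
        ∏ v, ∏ c ∈ X.children v, (T c).product := by
    simp only [scale, edgeProduct, ← Finset.prod_mul_distrib]
    refine Finset.prod_congr rfl fun v _ => ?_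
    rw [(h v).product_eq, isSome_inbox, prod_inbox, coins_eq_of_accepts h]
  refine mul_right_cancel₀ ?_
    ((X.mul_prod_prod_children fun v => (T v).product).trans prod_product)
  exact Finset.prod_ne_zero_iff.2 fun v _ => Finset.prod_ne_zero_iff.2 fun c _ =>
    (h c).product_ne_zero

theorem sum_mask_add_sum_contribution_of_accepts
    (h : ∀ v, S.Accepts v (ω v) (T v) (inbox X T v)) :
    ∑ v, (T v).mask + ∑ v, contribution S.color (T v) v = 0 := by
  have sum_total := X.add_sum_sum_children fun v => (T v).total
  rw [(h X.root).total_root rfl, zero_add,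
    Finset.sum_congr rfl fun v _ => (h v).total_eq] at sum_total
  simp only [sum_inbox, Finset.sum_add_distrib] at sum_total
  exact add_eq_right.1 sum_total.symm

theorem isRoot_globalTest_of_accepts (h : ∀ v, S.Accepts v (ω v) (T v) (inbox X T v)) :
    (globalTest S.color X.graph (scale ω) (S.publicCoins X.root ω) T).IsRoot
      (ω X.root).challenge :=
  (eval_globalTest (coins_eq_of_accepts h) (product_root_eq_of_accepts h)).trans
    (sum_mask_add_sum_contribution_of_accepts h)

variable (S) (r : Fin n)

theorem scale_update {v : Fin n} {c : NodeCoin F m} (hc : c.mult = (ω v).mult) :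
    scale (Function.update ω v c) = scale ω := by
  refine Finset.prod_congr rfl fun u _ => ?_
  rcases eq_or_ne u v with rfl | hu <;> simp [*]

theorem publicCoins_update_weight (v : Fin n) (z : F) :
    (S.publicCoins r (Function.update ω v { ω v with weight := z })).weight =
      Function.update (S.publicCoins r ω).weight v z := by
  funext u
  rcases eq_or_ne u v with rfl | hu <;> simp [publicCoins, *]

theorem publicCoins_update_index (v : Fin n) (i : Fin m) :
    S.publicCoins r (Function.update ω v { ω v with index := i }) =
      { S.publicCoins r ω with
        point := Function.update (S.publicCoins r ω).point v (S.point (v, i)) } := by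
  refine PublicCoins.ext (funext fun u => ?_) (funext fun u => ?_) ?_
  · rcases eq_or_ne u v with rfl | hu <;> simp [publicCoins, *]
  · rcases eq_or_ne u v with rfl | hu <;> simp [publicCoins, *]
  · rcases eq_or_ne r v with rfl | hu <;> simp [publicCoins, *]

theorem publicCoins_update_challenge (τ : F) :
    S.publicCoins r (Function.update ω r { ω r with challenge := τ }) =
      { S.publicCoins r ω with challenge := τ } := by
  refine PublicCoins.ext (funext fun u => ?_) (funext fun u => ?_) (by simp [publicCoins])
  · rcases eq_or_ne u r with rfl | hu <;> simp [publicCoins, *]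
  · rcases eq_or_ne u r with rfl | hu <;> simp [publicCoins, *]

end Accepting

end Setup

section Coordinates

variable {F : Type} [Field F] {m : ℕ}

/-- The weight base of a node, as a coordinate of its coins. -/
def weightCoordinate : Coordinate (NodeCoin F m) F where
  get c := c.weight
  set c z := { c with weight := z }
  get_set _ _ := rfl
  set_get _ := rfl
  set_set _ _ _ := rfl

/-- The index of the evaluation point of a node, as a coordinate of its coins. -/
def indexCoordinate : Coordinate (NodeCoin F m) (Fin m) where
  get c := c.index
  set c i := { c with index := i }
  get_set _ _ := rfl
  set_get _ := rfl
  set_set _ _ _ := rfl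

/-- The challenge of a node, as a coordinate of its coins. -/
def challengeCoordinate : Coordinate (NodeCoin F m) F where
  get c := c.challenge
  set c τ := { c with challenge := τ }
  get_set _ _ := rfl
  set_get _ := rfl
  set_set _ _ _ := rfl

end Coordinates

open ENNReal in
theorem error_bound_le_third {n k m q : ℕ} (hmq : m ≤ q) (hm : 3 * (n * k + n * n + (n + 1)) ≤ m) :
    (n * (k / q) + n * (n / m) + (n + 1 : ℕ) / q : ℝ≥0∞) ≤ 1 / 3 := by
  have div_le (a : ℝ≥0∞) : a / q ≤ a / m := ENNReal.div_le_div_left (by exact_mod_cast hmq) a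
  calc (n * (k / q) + n * (n / m) + (n + 1 : ℕ) / q : ℝ≥0∞)
      ≤ n * (k / m) + n * (n / m) + (n + 1 : ℕ) / m :=
        add_le_add (add_le_add_left (mul_le_mul_right (div_le _) _) _) (div_le _)
    _ = (n * k + n * n + (n + 1) : ℕ) / m := by
        push_cast
        simp only [ENNReal.add_div, mul_div_assoc]
    _ ≤ 1 / 3 := by
        refine ENNReal.div_le_of_le_mul ?_
        rw [one_div, ← ENNReal.div_eq_inv_mul, ENNReal.le_div_iff_mul_le (by simp) (by simp),
          mul_comm]
        exact_mod_cast hm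

namespace Setup

section BadEvents

variable {F : Type} [Field F] [Fintype F] {n m k l b : ℕ} [NeZero m] (S : Setup F n m k l b)
  (P : DistProver n l) (X : Network n)

/-- The test polynomial in an interaction with the prover `P`. -/
def interactionTest (ρ : JointCoins S.verifier P) : Polynomial F :=
  globalTest S.color X.graph (scale ρ.1) (S.publicCoins X.root ρ.1) (S.transcript P X ρ)

/-- The event that the weighted sum over the colourings that agree with `y` before `j` vanishes,
although it does not if they also agree with `y` in `j`. -/
def weightEvent (y : Fin n → F) (j : Fin n) : Set (JointCoins S.verifier P) :=
  {ρ | partialSum (S.publicCoins X.root ρ.1).weight S.color (edgeProduct X.graph) j.castSucc y = 0 ∧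
    partialSum (S.publicCoins X.root ρ.1).weight S.color (edgeProduct X.graph) j.succ y ≠ 0}

/-- The event that the `j`-th sumcheck polynomial of the prover is wrong, but has the right value
at the evaluation point. -/
def pointEvent (j : Fin n) : Set (JointCoins S.verifier P) :=
  {ρ | sharedPoly (S.transcript P X ρ) j ≠
      sumcheckPoly S.color X.graph (scale ρ.1) (S.publicCoins X.root ρ.1) j ∧
    (sharedPoly (S.transcript P X ρ) j).eval ((S.publicCoins X.root ρ.1).point j) =
      (sumcheckPoly S.color X.graph (scale ρ.1) (S.publicCoins X.root ρ.1) j).eval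
        ((S.publicCoins X.root ρ.1).point j)}

/-- The event that the test polynomial is not zero, but vanishes at the challenge. -/
def challengeEvent : Set (JointCoins S.verifier P) :=
  {ρ | S.interactionTest P X ρ ≠ 0 ∧ (S.interactionTest P X ρ).IsRoot (ρ.1 X.root).challenge}

theorem toOuterMeasure_weightEvent_le (y : Fin n → F) (hy : ∀ i, y i ∈ Set.range S.color)
    (j : Fin n) :
    (PMF.uniformOfFintype _).toOuterMeasure (S.weightEvent P X y j) ≤ k / Fintype.card F := by
  refine (weightCoordinate.atNode j).toOuterMeasure_uniformOfFintype_le_of_isRoot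
    Function.injective_id ?_
  rintro ρ ⟨-, hne⟩
  obtain ⟨a₀, ha₀⟩ := hy j
  let restSum (a : Fin k) : F := partialSum (S.publicCoins X.root ρ.1).weight S.color
    (edgeProduct X.graph) j.succ (Function.update y j (S.color a))
  refine ⟨∑ a : Fin k, .monomial (a : ℕ) (restSum a), fun hzero => hne ?_, ?_, ?_⟩
  · have hcoeff := congrArg (Polynomial.coeff · (a₀ : ℕ)) hzero
    simpa [Polynomial.finsetSum_coeff, Polynomial.coeff_monomial, Fin.val_inj, restSum, ha₀]
      using hcoeff
  · exact Polynomial.natDegree_sum_le_of_forall_le _ _ fun a _ =>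
      (Polynomial.natDegree_monomial_le _).trans a.isLt.le
  · rintro z ⟨hzero, -⟩
    simp only [Coordinate.atNode, weightCoordinate, publicCoins_update_weight,
      partialSum_castSucc, Function.update_self] at hzero
    rw [Polynomial.IsRoot, Polynomial.eval_finsetSum, ← hzero]
    refine Finset.sum_congr rfl fun a _ => ?_
    rw [Polynomial.eval_monomial, mul_comm, id, smul_eq_mul]
    refine congrArg _ (partialSum_congr (fun i hi => ?_) fun _ _ => rfl)
    rw [Function.update_of_ne (by grind)]

/-- The prover learns the evaluation point of `j` only after it has sent all shares of the `j`-th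
sumcheck polynomial. -/
theorem sharedPoly_transcript_update_index (ρ : JointCoins S.verifier P) (j : Fin n) (i : Fin m) :
    sharedPoly (S.transcript P X (Function.update ρ.1 j { ρ.1 j with index := i }, ρ.2)) j =
      sharedPoly (S.transcript P X ρ) j := by
  have message_eq := S.proverMessage_congr P X (t := j) (ρ' := ρ)
    (ρ := (Function.update ρ.1 j { ρ.1 j with index := i }, ρ.2)) rfl fun u s hs => by
      rcases eq_or_ne u j with rfl | hu
      · simp [nodeMessage, show s ≠ u + 1 by lia]
      · simp [hu]
  simp only [sharedPoly, transcript, Transcript.ofMessages, message_eq]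

theorem toOuterMeasure_pointEvent_le (j : Fin n) :
    (PMF.uniformOfFintype _).toOuterMeasure (S.pointEvent P X j) ≤ n / m := by
  refine ((indexCoordinate.atNode j).toOuterMeasure_uniformOfFintype_le_of_isRoot
    (φ := fun i => S.point (j, i)) (fun i i' h => by simpa using h) ?_).trans_eq
      (by rw [Fintype.card_fin])
  rintro ρ ⟨hne, -⟩
  refine ⟨sharedPoly (S.transcript P X ρ) j -
    sumcheckPoly S.color X.graph (scale ρ.1) (S.publicCoins X.root ρ.1) j,
    sub_ne_zero.2 hne, ?_, ?_⟩
  · exact Polynomial.natDegree_le_of_degree_le <| le_of_lt <| Polynomial.mem_degreeLT.1 <|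
      (Polynomial.degreeLT F n).sub_mem (sharedPoly_mem_degreeLT _ j)
        (sumcheckPoly_mem_degreeLT _ _ _ _ j)
  · rintro i ⟨-, heval⟩
    simp only [Coordinate.atNode, indexCoordinate, sharedPoly_transcript_update_index,
      publicCoins_update_index, scale_update, Function.update_self] at heval
    simp only [sumcheckPoly, Function.comp_update, Function.update_idem] at heval
    rw [Polynomial.IsRoot, Polynomial.eval_sub, sub_eq_zero, heval, sumcheckPoly]

/-- The prover learns the challenge only after it has sent everything that enters the test
polynomial. -/
theorem interactionTest_update_challenge (ρ : JointCoins S.verifier P) (τ : F) :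
    S.interactionTest P X
        (Function.update ρ.1 X.root { ρ.1 X.root with challenge := τ }, ρ.2) =
      S.interactionTest P X ρ := by
  have message_eq (t : ℕ) (ht : t ≤ n) := S.proverMessage_congr P X (t := t) (ρ' := ρ)
    (ρ := (Function.update ρ.1 X.root { ρ.1 X.root with challenge := τ }, ρ.2)) rfl
    fun u s hs => by
      rcases eq_or_ne u X.root with rfl | hu
      · simp [nodeMessage, show s ≠ n + 1 by lia]
      · simp [hu]
  simp only [interactionTest, globalTest, sharedPoly, transcript, Transcript.ofMessages,
    publicCoins_update_challenge, scale_update, message_eq 0 (Nat.zero_le n),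
    fun j : Fin n => message_eq j j.isLt.le]

theorem toOuterMeasure_challengeEvent_le :
    (PMF.uniformOfFintype _).toOuterMeasure (S.challengeEvent P X) ≤
      (n + 1 : ℕ) / Fintype.card F := by
  refine (challengeCoordinate.atNode X.root).toOuterMeasure_uniformOfFintype_le_of_isRoot
    Function.injective_id ?_
  rintro ρ ⟨hne, -⟩
  refine ⟨S.interactionTest P X ρ, hne, natDegree_testPoly_le .., ?_⟩
  rintro τ ⟨-, hroot⟩
  simpa only [Coordinate.atNode, challengeCoordinate, interactionTest_update_challenge,
    Function.update_self, id] using hroot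

theorem accepting_subset_iUnion {y : Fin n → F} (hy : edgeProduct X.graph y ≠ 0) :
    {ρ : JointCoins S.verifier P | ∀ v, S.verifier.verification.run X.graph
      (stateAfterInteraction S.verifier P X (rounds n) ρ) 1 v = true} ⊆
    ((⋃ j, S.weightEvent P X y j) ∪ ⋃ j, S.pointEvent P X j) ∪ S.challengeEvent P X := by
  intro ρ hρ
  simp only [Set.mem_ofPred_eq, S.run_eq_true_iff] at hρ
  by_contra hbad
  simp only [Set.mem_union, Set.mem_iUnion, not_or, not_exists] at hbad
  obtain ⟨⟨hweight, hpoint⟩, hchallenge⟩ := hbad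
  have htest : S.interactionTest P X ρ = 0 := by
    by_contra hne
    exact hchallenge ⟨hne, isRoot_globalTest_of_accepts hρ⟩
  have sum_eq_zero := sumcheckValue_zero_of_globalTest_eq_zero htest fun j heval => by
    by_contra hne
    exact hpoint j ⟨hne, heval⟩
  have sum_ne_zero : ∀ i, partialSum (S.publicCoins X.root ρ.1).weight S.color
      (edgeProduct X.graph) i y ≠ 0 := by
    intro i
    induction i using Fin.reverseInduction with
    | last => rwa [partialSum_last]
    | cast j ih => exact fun h => hweight j ⟨h, ih⟩
  rw [sumcheckValue_zero _ _ _ _ y] at sum_eq_zero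
  exact mul_ne_zero (scale_ne_zero ρ.1) (sum_ne_zero 0) sum_eq_zero

theorem acceptProb_le_third (hX : X.graph.Colorable k) (hF : m ≤ Fintype.card F)
    (hm : 3 * (n * k + n * n + (n + 1)) ≤ m) :
    acceptProb S.verifier P X (rounds n) 1 ≤ 1 / 3 := by
  obtain ⟨coloring⟩ := hX
  let y : Fin n → F := fun v => S.color (coloring v)
  have hy : edgeProduct X.graph y ≠ 0 := (edgeProduct_ne_zero_iff _ _).2 fun u v huv =>
    S.color.injective.ne (coloring.valid huv)
  let μ := (PMF.uniformOfFintype (JointCoins S.verifier P)).toOuterMeasure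
  refine ENNReal.toReal_le_of_le_ofReal (by norm_num) ?_
  calc μ _ ≤ μ (((⋃ j, S.weightEvent P X y j) ∪ ⋃ j, S.pointEvent P X j) ∪
        S.challengeEvent P X) := MeasureTheory.measure_mono (S.accepting_subset_iUnion P X hy)
    _ ≤ ∑ j, μ (S.weightEvent P X y j) + ∑ j, μ (S.pointEvent P X j) +
        μ (S.challengeEvent P X) := by
        refine (MeasureTheory.measure_union_le _ _).trans ?_
        gcongr
        refine (MeasureTheory.measure_union_le _ _).trans ?_
        gcongr <;> exact MeasureTheory.measure_iUnion_fintype_le _ _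
    _ ≤ ∑ _j : Fin n, (k / Fintype.card F : ENNReal) + ∑ _j : Fin n, (n / m : ENNReal) +
        (n + 1 : ℕ) / Fintype.card F := by
        gcongr with j _ j _
        · exact S.toOuterMeasure_weightEvent_le P X y (fun i => ⟨_, rfl⟩) j
        · exact S.toOuterMeasure_pointEvent_le P X j
        · exact S.toOuterMeasure_challengeEvent_le P X
    _ ≤ ENNReal.ofReal (1 / 3) := by
        simpa using error_bound_le_third hF hm

end BadEvents

end Setup

/-! ### Completeness -/

/-- The coins of the honest prover: the pads of the shares of the coefficients, and the masks that
hide the totals of the subtrees. -/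
@[ext]
structure ProverCoin (F : Type) (n : ℕ) where
  pad : Fin n → Fin n → F
  mask : Fin n → F

section ProverCoinInstances

variable {F : Type} [Field F] {n : ℕ}

instance [Finite F] : Finite (ProverCoin F n) :=
  .of_injective (fun p => (p.pad, p.mask)) fun p p' h => by cases p; cases p'; simp_all

instance [Finite F] : Fintype (ProverCoin F n) := .ofFinite _

instance : Nonempty (ProverCoin F n) := ⟨⟨0, 0⟩⟩

end ProverCoinInstances

section HonestTranscript

open Polynomial

variable {F : Type} [Field F] {n k : ℕ}

/-- The product of the multipliers and the vertex factors in the subtree of a node. -/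
def subtreeProduct (X : Network n) (mult r : Fin n → F) (v : Fin n) : F :=
  ∏ u ∈ X.subtree v, (mult u * vertexFactor (X.graph.Adj u) r u)

theorem subtreeProduct_eq (X : Network n) (mult r : Fin n → F) (v : Fin n) :
    subtreeProduct X mult r v = mult v * vertexFactor (X.graph.Adj v) r v *
      ∏ c ∈ X.children v, subtreeProduct X mult r c :=
  X.prod_subtree _ v

theorem subtreeProduct_root (X : Network n) (mult r : Fin n → F) :
    subtreeProduct X mult r X.root = (∏ v, mult v) * edgeProduct X.graph r := by
  rw [subtreeProduct, X.subtree_root, Finset.prod_mul_distrib, edgeProduct]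

/-- The mask of the total of a node; that of the root is zero. -/
def totalMask (y : Fin n → F) (v : Fin n) : F := if v.val = 0 then 0 else y v

theorem totalMask_root (X : Network n) (y : Fin n → F) : totalMask y X.root = 0 := if_pos rfl

variable (color : Fin k → F) (X : Network n) (p : ProverCoin F n) (mult : Fin n → F)
  (c : PublicCoins F n)

/-- The transcript of a node in an interaction with the honest prover, except for the total. -/
def honestBase (v : Fin n) : Transcript F n where
  shareLeft j := (sumcheckPoly color X.graph (∏ u, mult u) c j).coeff v + p.pad j v
  shareRight j := -p.pad j (finRotate n v)
  coins := c
  mask := totalMask p.mask v - ∑ u ∈ X.children v, totalMask p.mask u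
  product := subtreeProduct X mult c.point v
  total := 0

/-- The transcript of a node in an interaction with the honest prover. -/
def honestTranscript (v : Fin n) : Transcript F n :=
  { honestBase color X p mult c v with
    total := totalMask p.mask v +
      ∑ u ∈ X.subtree v, contribution color (honestBase color X p mult c u) u }

theorem sharedPoly_honestBase (j : Fin n) :
    sharedPoly (honestBase color X p mult c) j =
      sumcheckPoly color X.graph (∏ u, mult u) c j := by
  have sum_pad := Equiv.sum_comp (finRotate n) fun v : Fin n => monomial (v : ℕ) (p.pad j v)
  have sum_coeff := Polynomial.sum_fin (fun i a => monomial i a) (fun i => monomial_zero_right i)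
    (mem_degreeLT.1 (sumcheckPoly_mem_degreeLT color X.graph (∏ u, mult u) c j))
  rw [sum_monomial_eq] at sum_coeff
  simp only [sharedPoly, honestBase, map_add, map_neg, Finset.sum_add_distrib,
    Finset.sum_neg_distrib, sum_pad, sum_coeff]
  ring

variable {X} in
theorem sumcheckValue_zero_of_not_colorable (hX : ¬ X.graph.Colorable k) (s : F) :
    sumcheckValue color X.graph s c 0 = 0 := by
  refine mul_eq_zero_of_right s ((Submodule.mem_bot F).1 (partialSum_mem fun y _ hy => ?_))
  rw [Submodule.mem_bot]
  by_contra hne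
  choose a ha using fun v => hy v (Fin.zero_le _)
  refine hX ⟨SimpleGraph.Coloring.mk a fun {u v} huv heq => ?_⟩
  exact (edgeProduct_ne_zero_iff _ _).1 hne u v huv (by rw [← ha, ← ha, heq])

variable {X} in
theorem sum_contribution_honestBase (hX : ¬ X.graph.Colorable k) :
    ∑ v, contribution color (honestBase color X p mult c v) v = 0 := by
  let value := sumcheckValue color X.graph (∏ u, mult u) c
  have test_eq_zero : testPoly 0 (Fin.init value) (Fin.tail value) (value (Fin.last n)) = 0 := by
    refine testPoly_eq_zero_iff.2 ⟨rfl, ?_⟩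
    rw [Fin.snoc_init_self, ← sumcheckValue_zero_of_not_colorable color c hX (∏ u, mult u)]
    exact (Fin.cons_self_tail value).symm
  rw [sum_contribution color X (T := honestBase color X p mult c) fun _ => rfl]
  simp only [roundTest_apply, sharedPoly_honestBase, sum_eval_color_sumcheckPoly,
    eval_point_sumcheckPoly, honestBase, subtreeProduct_root,
    ← sumcheckValue_last color X.graph]
  have eval_test := congrArg (eval c.challenge) test_eq_zero
  rw [eval_zero, eval_testPoly, zero_add] at eval_test
  exact eval_test

theorem total_honestTranscript (v : Fin n) :
    (honestTranscript color X p mult c v).total = (honestTranscript color X p mult c v).mask +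
      contribution color (honestTranscript color X p mult c v) v +
      ∑ u ∈ X.children v, (honestTranscript color X p mult c u).total := by
  simp only [honestTranscript]
  rw [X.sum_subtree, Finset.sum_add_distrib]
  simp only [honestBase, contribution]
  ring

variable {X} in
theorem total_honestTranscript_root (hX : ¬ X.graph.Colorable k) :
    (honestTranscript color X p mult c X.root).total = 0 := by
  simp only [honestTranscript, X.subtree_root, sum_contribution_honestBase color p mult c hX,
    totalMask_root, add_zero]

theorem extend_congr {α β γ : Type*} {f : α → β} {g g' : α → γ} {e : β → γ} {y : β}
    (h : ∀ x, f x = y → g x = g' x) : Function.extend f g e y = Function.extend f g' e y := by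
  unfold Function.extend
  split_ifs with hy
  · exact h _ hy.choose_spec
  · rfl

/-- The honest prover can send the message of round `t` before the later evaluation points, and the
challenge, are revealed. -/
theorem message_honestTranscript_congr {c c' : PublicCoins F n} {t : ℕ}
    (hweight : c.weight = c'.weight) (hpoint : ∀ i : Fin n, (i : ℕ) < t → c.point i = c'.point i)
    (hchallenge : t = n + 1 → c.challenge = c'.challenge) (v : Fin n) :
    (honestTranscript color X p mult c v).message t =
      (honestTranscript color X p mult c' v).message t := by
  by_cases ht : t = n + 1
  · have hc : c = c' :=
      PublicCoins.ext hweight (funext fun i => hpoint i (by lia)) (hchallenge ht)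
    rw [hc]
  have coeff_eq : ∀ j : Fin n, (j : ℕ) = t →
      sumcheckPoly color X.graph (∏ u, mult u) c j =
        sumcheckPoly color X.graph (∏ u, mult u) c' j := by
    rintro j rfl
    refine congrArg (_ • ·) ?_
    rw [hweight]
    refine partialSum_congr (fun _ _ => rfl) fun i hi => ?_
    rcases eq_or_ne i j with rfl | hij
    · simp
    · simp [hij, hpoint i (by grind)]
  simp only [Transcript.message, honestTranscript, honestBase, hweight, if_neg ht]
  congr 1
  · exact extend_congr fun j hj => by rw [coeff_eq j hj]
  · exact extend_congr fun i hi => hpoint i (by lia)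

end HonestTranscript

namespace Setup

variable {F : Type} [Field F] {n m k l b : ℕ} (S : Setup F n m k l b)

theorem point_publicCoins_injective (r : Fin n) (ω : Fin n → NodeCoin F m) :
    (S.publicCoins r ω).point.Injective := fun u v h => by
  simpa using congrArg Prod.fst (S.point.injective h)

theorem subtreeProduct_ne_zero (X : Network n) (ω : Fin n → NodeCoin F m) (v : Fin n) :
    subtreeProduct X (fun u => ((ω u).mult : F)) (S.publicCoins X.root ω).point v ≠ 0 :=
  Finset.prod_ne_zero_iff.2 fun u _ => mul_ne_zero (ω u).mult.ne_zero
    (vertexFactor_ne_zero _ (S.point_publicCoins_injective X.root ω) u)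

/-- The transcript of a node in an interaction with the honest prover, as a function of all
coins. -/
def honestView (X : Network n) (ρ : (Fin n → NodeCoin F m) × ProverCoin F n) (v : Fin n) :
    Transcript F n :=
  honestTranscript S.color X ρ.2 (fun u => ((ρ.1 u).mult : F)) (S.publicCoins X.root ρ.1) v

/-- The message of round `t` of the honest prover to a node, computed from the messages
`revealed s u` of the nodes `u` in the rounds `s`. -/
def honestMessage (X : Network n) (p : ProverCoin F n) (revealed : ℕ → Fin n → NodeMessage F)
    (t : ℕ) (v : Fin n) : ProverMessage F :=
  let coins : PublicCoins F n :=
    { weight := fun u => (revealed 0 u).weight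
      point := fun u => (revealed (u + 1) u).point
      challenge := (revealed (n + 1) X.root).challenge }
  (honestTranscript S.color X p (fun u => (revealed 0 u).mult) coins v).message t

theorem honestMessage_eq (X : Network n) (ρ : (Fin n → NodeCoin F m) × ProverCoin F n)
    {revealed : ℕ → Fin n → NodeMessage F} {t : ℕ}
    (h : ∀ s ≤ t, ∀ u, revealed s u = S.nodeMessage u (ρ.1 u) s) (v : Fin n) :
    S.honestMessage X ρ.2 revealed t v = (S.honestView X ρ v).message t := by
  rw [honestMessage, honestView]
  simp only [h 0 (Nat.zero_le t), nodeMessage]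
  refine message_honestTranscript_congr _ _ _ _ ?_ (fun i hi => ?_) (fun ht => ?_) v
  · rfl
  · simp [h _ (Nat.succ_le_of_lt hi), nodeMessage, publicCoins]
  · simp [h _ ht.ge, nodeMessage, publicCoins]

/-- The honest prover. -/
abbrev honestProver [Fintype F] (X : Network n) : DistProver n l where
  Coin := ProverCoin F n
  message p L v := S.proverCode <| S.honestMessage X p
    (fun s u => Function.invFun S.nodeCode (L.getD (2 * s) default u)) (L.length / 2) v

theorem accepts_honestView {X : Network n} (hX : ¬ X.graph.Colorable k)
    (ρ : (Fin n → NodeCoin F m) × ProverCoin F n) (v : Fin n) :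
    S.Accepts v (ρ.1 v) (S.honestView X ρ v) (inbox X (S.honestView X ρ) v) where
  coins_eq u M hM := by rw [← ((mem_inbox ..).1 hM).2]; rfl
  weight_eq := rfl
  point_eq := rfl
  challenge_eq hv := by rw [X.eq_root_iff.2 hv]; rfl
  product_ne_zero := S.subtreeProduct_ne_zero X ρ.1 v
  product_eq := by rw [isSome_inbox, prod_inbox]; exact subtreeProduct_eq ..
  total_eq := by rw [sum_inbox]; exact total_honestTranscript ..
  total_root hv := by
    rw [X.eq_root_iff.2 hv]
    exact total_honestTranscript_root _ _ _ _ hX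

section Execution

variable [Fintype F] [NeZero m] (X : Network n)

theorem messageAt_even (P : DistProver n l) (ρ : JointCoins S.verifier P) {t : ℕ}
    (ht : t ≤ n + 1) (v : Fin n) :
    messageAt S.verifier P X (rounds n) ρ (2 * t) v = S.nodeCode (S.nodeMessage v (ρ.1 v) t) := by
  have not_odd : ¬ Odd (rounds n - 2 * t) := by grind
  rw [messageAt, if_neg not_odd]
  simp [length_conversation, Network.localInput]

theorem messageAt_odd (ρ : JointCoins S.verifier (S.honestProver X)) {t : ℕ} (ht : t ≤ n + 1)
    (v : Fin n) :
    messageAt S.verifier (S.honestProver X) X (rounds n) ρ (2 * t + 1) v =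
      S.proverCode ((S.honestView X ρ v).message t) := by
  have is_odd : Odd (rounds n - (2 * t + 1)) := by grind
  have half_length : (2 * t + 1) / 2 = t := by lia
  rw [messageAt, if_pos is_odd]
  simp only [length_conversation, half_length]
  refine congrArg S.proverCode (S.honestMessage_eq X ρ (fun s hs u => ?_) v)
  rw [getD_conversation _ _ _ _ _ (by lia), S.messageAt_even X _ _ (by lia),
    Function.leftInverse_invFun S.nodeCode.injective]

theorem transcript_honestProver (ρ : JointCoins S.verifier (S.honestProver X)) :
    S.transcript (S.honestProver X) X ρ = S.honestView X ρ := by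
  funext v
  rw [← Transcript.ofMessages_message (S.honestView X ρ v)]
  refine Transcript.ofMessages_congr fun t ht => ?_
  rw [proverMessage, S.messageAt_odd X ρ ht,
    Function.leftInverse_invFun S.proverCode.injective]

variable {X} in
theorem acceptProb_honestProver (hX : ¬ X.graph.Colorable k) :
    acceptProb S.verifier (S.honestProver X) X (rounds n) 1 = 1 := by
  have accepting_eq : {ρ : JointCoins S.verifier (S.honestProver X) |
      ∀ v, S.verifier.verification.run X.graph
        (stateAfterInteraction S.verifier (S.honestProver X) X (rounds n) ρ) 1 v = true} =
      Set.univ := Set.eq_univ_of_forall fun ρ v => by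
    rw [run_eq_true_iff, transcript_honestProver]
    exact S.accepts_honestView hX ρ v
  rw [acceptProb, accepting_eq, (PMF.toOuterMeasure_apply_eq_one_iff _ _).2 (Set.subset_univ _),
    ENNReal.toReal_one]

end Execution

end Setup

/-! ### Zero knowledge -/

section Uniform

theorem map_uniformOfFintype_of_bijective {α β : Type*} [Fintype α] [Nonempty α] [Fintype β]
    [Nonempty β] {f : α → β} (hf : f.Bijective) :
    (PMF.uniformOfFintype α).map f = PMF.uniformOfFintype β := by
  classical
  ext y
  obtain ⟨x, rfl⟩ := hf.surjective y
  rw [PMF.map_apply, tsum_eq_single x fun x' hx' => if_neg fun h => hx' (hf.injective h).symm]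
  simp [Fintype.card_of_bijective hf]

theorem map_fst_uniformOfFintype {α β : Type*} [Fintype α] [Nonempty α] [Fintype β]
    [Nonempty β] : (PMF.uniformOfFintype (α × β)).map Prod.fst = PMF.uniformOfFintype α := by
  classical
  ext x
  have card_ne_zero : (Fintype.card β : ENNReal) ≠ 0 := by simp
  have card_ne_top : (Fintype.card β : ENNReal) ≠ ⊤ := by simp
  rw [PMF.map_apply, tsum_fintype, Fintype.sum_prod_type]
  simp only [PMF.uniformOfFintype_apply, Fintype.card_prod, Nat.cast_mul]
  calc ∑ a, ∑ _b : β, (if x = a then ((Fintype.card α : ENNReal) * Fintype.card β)⁻¹ else 0)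
      = Fintype.card β * ((Fintype.card α : ENNReal) * Fintype.card β)⁻¹ := by simp
    _ = (Fintype.card α : ENNReal)⁻¹ := by
        rw [ENNReal.mul_inv (.inr card_ne_top) (.inr card_ne_zero), mul_left_comm,
          ENNReal.mul_inv_cancel card_ne_zero card_ne_top, mul_one]

theorem map_eval_uniformOfFintype {ι α : Type*} [Fintype ι] [DecidableEq ι] [Fintype α]
    [Nonempty α] (i : ι) :
    (PMF.uniformOfFintype (ι → α)).map (fun f => f i) = PMF.uniformOfFintype α := by
  rw [← map_fst_uniformOfFintype (α := α) (β := {j // j ≠ i} → α),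
    ← map_uniformOfFintype_of_bijective (Equiv.funSplitAt i α).bijective, PMF.map_comp]
  rfl

theorem tvDist_self {α : Type} (p : PMF α) : tvDist p p = 0 := by simp [tvDist]

end Uniform

theorem eq_of_subtreeProduct_eq {F : Type} [Field F] {n : ℕ} {X : Network n}
    {mult mult' r : Fin n → F} (hne : ∀ v, subtreeProduct X mult r v ≠ 0)
    (h : ∀ v, subtreeProduct X mult r v = subtreeProduct X mult' r v) : mult = mult' := by
  funext v
  have factors_ne_zero := hne v
  have hv := h v
  rw [subtreeProduct_eq] at factors_ne_zero
  rw [subtreeProduct_eq, subtreeProduct_eq,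
    Finset.prod_congr rfl fun c _ => (h c).symm] at hv
  exact mul_right_cancel₀ (right_ne_zero_of_mul (left_ne_zero_of_mul factors_ne_zero))
    (mul_right_cancel₀ (right_ne_zero_of_mul factors_ne_zero) hv)

namespace Setup

variable {F : Type} [Field F] {n m k l b : ℕ} (S : Setup F n m k l b)

/-- All coins of an interaction with the honest prover. A node of the simulator draws coins of the
same shape, and reads the multipliers as products of subtrees, the pads as shares, and the masks as
totals of subtrees. -/
abbrev AllCoins (F : Type) [Field F] (n m : ℕ) : Type := (Fin n → NodeCoin F m) × ProverCoin F n

/-- The simulated transcript of a node, except for the mask. -/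
def simBase (ξ : AllCoins F n m) (v : Fin n) : Transcript F n where
  shareLeft j := ξ.2.pad j v
  shareRight j := -ξ.2.pad j (finRotate n v)
  coins := S.publicCoins ⟨0, v.pos⟩ ξ.1
  mask := 0
  product := (ξ.1 v).mult
  total := totalMask ξ.2.mask v

/-- The simulated transcript of a node `v` with set of children `K`. -/
def simTranscript (ξ : AllCoins F n m) (K : Finset (Fin n)) (v : Fin n) : Transcript F n :=
  { S.simBase ξ v with
    mask := totalMask ξ.2.mask v - contribution S.color (S.simBase ξ v) v -
      ∑ u ∈ K, totalMask ξ.2.mask u }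

/-- The simulated coins of a node `v` with set of neighbours `N` and set of children `K`. -/
def simCoin (ξ : AllCoins F n m) (N : Fin n → Prop) (K : Finset (Fin n)) (v : Fin n) :
    NodeCoin F m :=
  { ξ.1 v with
    mult := (ξ.1 v).mult * (Units.mk0 _
      (vertexFactor_ne_zero N (S.point_publicCoins_injective ⟨0, v.pos⟩ ξ.1) v) *
        ∏ u ∈ K, (ξ.1 u).mult)⁻¹ }

open Classical in
/-- The simulated messages of the neighbours of a node `v`. -/
def simInbox (ξ : AllCoins F n m) (N : Fin n → Prop) (K : Finset (Fin n)) (v u : Fin n) :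
    Option (EdgeMessage F n) :=
  if N u then some
    { coins := S.publicCoins ⟨0, v.pos⟩ ξ.1
      product := if u ∈ K then ((ξ.1 u).mult : F) else 1
      total := if u ∈ K then totalMask ξ.2.mask u else 0 }
  else none

/-- The coins with which the simulator at `v` produces the view of `v` in the interaction with
coins `ρ`. -/
def simulatedCoins (X : Network n) (v : Fin n) (ρ : AllCoins F n m) : AllCoins F n m :=
  (fun u => { ρ.1 u with mult := Units.mk0 _ (S.subtreeProduct_ne_zero X ρ.1 u) },
    { pad := fun j => Function.update (ρ.2.pad j) v ((S.honestView X ρ v).shareLeft j)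
      mask := fun u => if u.val = 0 then ρ.2.mask u else (S.honestView X ρ u).total })

section SimulatedCoins

variable (X : Network n) (v : Fin n)

variable {S X v} in
theorem fst_eq_of_simulatedCoins_eq {ρ ρ' : AllCoins F n m}
    (h : S.simulatedCoins X v ρ = S.simulatedCoins X v ρ') : ρ.1 = ρ'.1 := by
  have coins_eq : S.publicCoins X.root ρ.1 = S.publicCoins X.root ρ'.1 :=
    congrArg (fun ξ => S.publicCoins X.root ξ.1) h
  have product_eq (u : Fin n) :
      subtreeProduct X (fun w => ((ρ.1 w).mult : F)) (S.publicCoins X.root ρ.1).point u =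
        subtreeProduct X (fun w => ((ρ'.1 w).mult : F)) (S.publicCoins X.root ρ.1).point u :=
    (congrArg (fun ξ => ((ξ.1 u).mult : F)) h).trans (by rw [coins_eq]; rfl)
  have mult_eq := eq_of_subtreeProduct_eq (S.subtreeProduct_ne_zero X ρ.1) product_eq
  funext u
  refine NodeCoin.ext ?_ (Units.ext (congrFun mult_eq u)) ?_ ?_
  · exact congrArg (fun ξ => (ξ.1 u).weight) h
  · exact congrArg (fun ξ => (ξ.1 u).index) h
  · exact congrArg (fun ξ => (ξ.1 u).challenge) h

theorem simulatedCoins_injective : (S.simulatedCoins X v).Injective := by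
  rintro ⟨ω, pad, mask⟩ ⟨ω', pad', mask'⟩ h
  obtain rfl : ω = ω' := fst_eq_of_simulatedCoins_eq h
  obtain rfl : pad = pad' := by
    funext j u
    have pad_eq := congrArg (fun ξ => ξ.2.pad j u) h
    simp only [simulatedCoins] at pad_eq
    rcases eq_or_ne u v with rfl | hu
    · simpa [honestView, honestTranscript, honestBase] using pad_eq
    · simpa [hu] using pad_eq
  obtain rfl : mask = mask' := by
    funext u
    have mask_eq := congrArg (fun ξ => ξ.2.mask u) h
    simp only [simulatedCoins] at mask_eq
    by_cases hu : u.val = 0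
    · simpa [hu] using mask_eq
    · simpa [hu, honestView, honestTranscript, honestBase, contribution, totalMask] using mask_eq
  rfl

variable {X} (hX : ¬ X.graph.Colorable k) (ρ : AllCoins F n m)

include hX in
theorem totalMask_simulatedCoins (u : Fin n) :
    totalMask (S.simulatedCoins X v ρ).2.mask u = (S.honestView X ρ u).total := by
  by_cases hu : u.val = 0
  · rw [X.eq_root_iff.2 hu, totalMask_root]
    exact (total_honestTranscript_root _ _ _ _ hX).symm
  · simp [totalMask, simulatedCoins, hu]

theorem simCoin_simulatedCoins :
    S.simCoin (S.simulatedCoins X v ρ) (X.graph.Adj v) (X.children v) v = ρ.1 v := by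
  refine NodeCoin.ext rfl (Units.ext ?_) rfl rfl
  simp only [simCoin]
  rw [← div_eq_mul_inv, Units.val_div_eq_div_val, div_eq_iff (Units.ne_zero _), Units.val_mul,
    Units.coe_prod, Units.val_mk0, ← mul_assoc]
  exact subtreeProduct_eq X (fun u => ((ρ.1 u).mult : F)) _ v

include hX in
theorem simBase_simulatedCoins (hn : 2 ≤ n) :
    S.simBase (S.simulatedCoins X v ρ) v = { S.honestView X ρ v with mask := 0 } := by
  have rotate_ne : finRotate n v ≠ v := by
    rw [← Equiv.Perm.mem_support, support_finRotate_of_le hn]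
    exact Finset.mem_univ v
  have shareLeft_eq (j : Fin n) :
      (S.simulatedCoins X v ρ).2.pad j v = (S.honestView X ρ v).shareLeft j :=
    Function.update_self ..
  have shareRight_eq (j : Fin n) :
      (S.simulatedCoins X v ρ).2.pad j (finRotate n v) = ρ.2.pad j (finRotate n v) :=
    Function.update_of_ne rotate_ne ..
  simp only [simBase, shareLeft_eq, shareRight_eq, S.totalMask_simulatedCoins v hX ρ]
  rfl

include hX in
theorem simTranscript_simulatedCoins (hn : 2 ≤ n) :
    S.simTranscript (S.simulatedCoins X v ρ) (X.children v) v = S.honestView X ρ v := by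
  have total_eq := total_honestTranscript S.color X ρ.2 (fun u => ((ρ.1 u).mult : F))
    (S.publicCoins X.root ρ.1)
  have mask_eq : (S.honestView X ρ v).total -
      contribution S.color { S.honestView X ρ v with mask := 0 } v -
      ∑ u ∈ X.children v, (S.honestView X ρ u).total = (S.honestView X ρ v).mask := by
    rw [honestView, total_eq]
    simp only [honestView, contribution]
    ring
  simp only [simTranscript, S.simBase_simulatedCoins v hX ρ hn, S.totalMask_simulatedCoins v hX ρ,
    mask_eq]

include hX in
theorem simInbox_simulatedCoins :
    S.simInbox (S.simulatedCoins X v ρ) (X.graph.Adj v) (X.children v) v =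
      inbox X (S.honestView X ρ) v := by
  funext u
  by_cases hadj : X.graph.Adj v u
  · have mem_children_iff : u ∈ X.children v ↔ X.parent u = v := by
      simp [Network.children, hadj]
    simp only [simInbox, inbox, if_pos hadj, if_pos hadj.symm, mem_children_iff,
      S.totalMask_simulatedCoins v hX ρ]
    rfl
  · rw [simInbox, inbox, if_neg hadj, if_neg (mt X.graph.adj_symm hadj)]

end SimulatedCoins

section Simulator

variable [Fintype F] [NeZero m]

/-- The view that consists of given coins, transcript and messages of neighbours. -/
def viewOf (v : Fin n) (c : NodeCoin F m) (T : Transcript F n)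
    (I : Fin n → Option (EdgeMessage F n)) : NodeView S.verifier :=
  (c, (List.range (rounds n)).map fun i =>
      if Even i then S.nodeCode (S.nodeMessage v c (i / 2)) else S.proverCode (T.message (i / 2)),
    [fun u => (I u).map S.edgeCode])

/-- The view that the simulator makes up at a node `v` with set of neighbours `N` and set of
children `K`. -/
def simView (ξ : AllCoins F n m) (N : Fin n → Prop) (K : Finset (Fin n)) (v : Fin n) :
    NodeView S.verifier :=
  S.viewOf v (S.simCoin ξ N K v) (S.simTranscript ξ K v) (S.simInbox ξ N K v)

open Classical in
/-- The simulator: every node tells its neighbours whether they are its parent, and then makes up a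
view on its own. -/
abbrev simulator : Simulator S.verifier where
  Coin := AllCoins F n m
  algorithm :=
    { send := fun s _ v => S.edgeCode ⟨⟨0, 0, 0⟩, if s.1.parent = v then 1 else 0, 0⟩
      output := fun s I =>
        let decoded (u : Fin n) : Option (EdgeMessage F n) :=
          (I.headD (fun _ => none) u).map (Function.invFun S.edgeCode)
        S.simView s.2 (fun u => (decoded u).isSome) {u | ∃ M ∈ decoded u, M.product = 1} s.1.id }

variable (X : Network n)

theorem run_simulator (ξ : Fin n → AllCoins F n m) (v : Fin n) :
    S.simulator.algorithm.run X.graph (fun u => (X.localInput u, ξ u)) 1 v =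
      S.simView (ξ v) (X.graph.Adj v) (X.children v) v := by
  classical
  let decoded (u : Fin n) : Option (EdgeMessage F n) :=
    if X.graph.Adj u v then some ⟨⟨0, 0, 0⟩, if X.parent u = v then 1 else 0, 0⟩ else none
  have neighbors_eq : (fun u => ((decoded u).isSome : Prop)) = X.graph.Adj v := by
    funext u
    by_cases h : X.graph.Adj u v <;> simp [decoded, h, X.graph.adj_comm v u]
  have children_eq : ({u | ∃ M ∈ decoded u, M.product = 1} : Finset (Fin n)) = X.children v := by
    ext u
    by_cases h : X.graph.Adj u v <;> simp [decoded, h, Network.children, X.graph.adj_comm v u]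
  have decode_encode : ∀ u, (if X.graph.Adj u v then some (S.edgeCode
      ⟨⟨0, 0, 0⟩, if X.parent u = v then 1 else 0, 0⟩) else none).map
      (Function.invFun S.edgeCode) = decoded u := fun u => by
    simp only [decoded, apply_ite (Option.map _), Option.map_some, Option.map_none,
      Function.leftInverse_invFun S.edgeCode.injective _]
  rw [← neighbors_eq, ← children_eq]
  simp only [DistAlgorithm.run, DistAlgorithm.received, List.nil_append, List.headD_cons,
    Network.localInput, ← decode_encode]
  congr!

theorem view_honestProver (ρ : JointCoins S.verifier (S.honestProver X)) (v : Fin n) :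
    (ρ.1 v, (conversation S.verifier (S.honestProver X) X (rounds n) ρ (rounds n)).map (· v),
      S.verifier.verification.received X.graph
        (stateAfterInteraction S.verifier (S.honestProver X) X (rounds n) ρ) 1 v) =
    S.viewOf v (ρ.1 v) (S.honestView X ρ v) (inbox X (S.honestView X ρ) v) := by
  rw [received_eq, transcript_honestProver, viewOf, conversation_eq_map, List.map_map]
  congr 2
  refine List.map_congr_left fun i hi => ?_
  rw [List.mem_range, rounds] at hi
  rcases Nat.even_or_odd' i with ⟨t, rfl | rfl⟩
  · rw [if_pos (even_two_mul t), Nat.mul_div_cancel_left _ two_pos]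
    exact S.messageAt_even X _ ρ (by lia) v
  · rw [if_neg (by simp), show (2 * t + 1) / 2 = t by lia]
    exact S.messageAt_odd X ρ (by lia) v

variable {X}

theorem simView_simulatedCoins (hn : 2 ≤ n) (hX : ¬ X.graph.Colorable k) (v : Fin n)
    (ρ : AllCoins F n m) :
    S.simView (S.simulatedCoins X v ρ) (X.graph.Adj v) (X.children v) v =
      S.viewOf v (ρ.1 v) (S.honestView X ρ v) (inbox X (S.honestView X ρ) v) := by
  rw [simView, simCoin_simulatedCoins, S.simTranscript_simulatedCoins v hX ρ hn,
    S.simInbox_simulatedCoins v hX ρ]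

theorem simDist_eq_viewDist (hn : 2 ≤ n) (hX : ¬ X.graph.Colorable k) (v : Fin n) :
    simDist S.simulator X 1 v = viewDist S.verifier (S.honestProver X) X (rounds n) 1 v := by
  let view (ξ : AllCoins F n m) : NodeView S.verifier :=
    S.simView ξ (X.graph.Adj v) (X.children v) v
  have sim_eq : simDist S.simulator X 1 v =
      (PMF.uniformOfFintype (AllCoins F n m)).map view := by
    rw [← map_eval_uniformOfFintype (ι := Fin n) v, PMF.map_comp]
    exact congrArg (PMF.map · _) (funext fun ξ => S.run_simulator X ξ v)
  have view_eq : viewDist S.verifier (S.honestProver X) X (rounds n) 1 v =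
      (PMF.uniformOfFintype (AllCoins F n m)).map (view ∘ S.simulatedCoins X v) :=
    congrArg (PMF.map · _) (funext fun ρ => (S.view_honestProver X ρ v).trans
      (S.simView_simulatedCoins hn hX v ρ).symm)
  rw [sim_eq, view_eq, ← PMF.map_comp, map_uniformOfFintype_of_bijective
    (Finite.injective_iff_bijective.1 (S.simulatedCoins_injective X v))]

end Simulator

end Setup

/-! ### Choice of the parameters -/

theorem Setup.nonColorability_mem_dStatZK {F : ℕ → Type} [∀ n, Field (F n)] [∀ n, Fintype (F n)]
    {k : ℕ} {m l b : ℕ → ℕ} [∀ n, NeZero (m n)] (S : ∀ n, Setup (F n) n (m n) k (l n) (b n))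
    (hF : ∀ n, m n ≤ Fintype.card (F n)) (hm : ∀ n, 3 * (n * k + n * n + (n + 1)) ≤ m n) :
    nonColorability k ∈ dStatZK rounds l (fun _ => 1) b := by
  refine ⟨fun n => (S n).verifier, fun n X => (S n).honestProver X, fun n => (S n).simulator,
    ⟨fun n X hX => ?_, fun n X hX P => ?_⟩, fun d => ?_⟩
  · rw [(S n).acceptProb_honestProver hX]
    norm_num
  · exact (S n).acceptProb_le_third P X (not_not.1 hX) (hF n) (hm n)
  · filter_upwards [eventually_ge_atTop 2] with n hn X hX v
    rw [(S n).simDist_eq_viewDist hn hX v, tvDist_self]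
    positivity

section Encoding

variable {F : Type} [Fintype F]

theorem nonempty_embedding_bitString {α ι : Type*} [Fintype ι] {f : α → ι → F}
    (hf : f.Injective) {a : ℕ} (hι : Fintype.card ι ≤ a) :
    Nonempty (α ↪ BitString (a * Nat.clog 2 (Fintype.card F))) := by
  classical
  have card_le : Fintype.card (ι → F) ≤
      Fintype.card (BitString (a * Nat.clog 2 (Fintype.card F))) := by
    rw [Fintype.card_fun, Fintype.card_fun, Fintype.card_bool, Fintype.card_fin, mul_comm, pow_mul]
    calc Fintype.card F ^ Fintype.card ι
        ≤ (2 ^ Nat.clog 2 (Fintype.card F)) ^ Fintype.card ι :=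
          Nat.pow_le_pow_left (Nat.le_pow_clog one_lt_two _) _
      _ ≤ (2 ^ Nat.clog 2 (Fintype.card F)) ^ a :=
          Nat.pow_le_pow_right (Nat.two_pow_pos _) hι
  exact (Function.Embedding.nonempty_of_card_le card_le).map (Function.Embedding.trans ⟨f, hf⟩)

theorem exists_setup {n m k : ℕ} (hm : n * m ≤ Fintype.card F) (hk : k ≤ Fintype.card F) :
    Nonempty (Setup F n m k (8 * Nat.clog 2 (Fintype.card F))
      ((2 * n + 3) * Nat.clog 2 (Fintype.card F))) := by
  obtain ⟨point⟩ := Function.Embedding.nonempty_of_card_le (α := Fin n × Fin m) (β := F)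
    (by simpa using hm)
  obtain ⟨color⟩ := Function.Embedding.nonempty_of_card_le (α := Fin k) (β := F) (by simpa using hk)
  obtain ⟨nodeCode⟩ := nonempty_embedding_bitString (α := NodeMessage F) (a := 8)
    (f := fun M => ![M.weight, M.mult, M.point, M.challenge])
    (fun M M' h => by cases M; cases M'; simp_all) (by simp)
  obtain ⟨proverCode⟩ := nonempty_embedding_bitString (α := ProverMessage F) (a := 8)
    (f := fun M => ![M.shareLeft, M.shareRight, M.weight, M.point, M.mask, M.product, M.total,
      M.challenge])
    (fun M M' h => by cases M; cases M'; simp_all) (by simp)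
  obtain ⟨edgeCode⟩ := nonempty_embedding_bitString (α := EdgeMessage F n) (a := 2 * n + 3)
    (f := fun M => Sum.elim (Sum.elim M.coins.weight M.coins.point)
      ![M.coins.challenge, M.product, M.total])
    (fun M M' h => by
      rcases M with ⟨⟨_, _, _⟩, _, _⟩
      rcases M' with ⟨⟨_, _, _⟩, _, _⟩
      simp_all [Sum.elim_eq_iff]) (by simp [two_mul])
  exact ⟨⟨point, color, nodeCode, proverCode, edgeCode⟩⟩

end Encoding

/-- The number of evaluation points from which each node chooses. -/
def numPoints (k n : ℕ) : ℕ := 3 * (n * k + n * n + (n + 1))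

instance (k n : ℕ) : NeZero (numPoints k n) := ⟨by simp [numPoints]⟩

/-- A size of the field that leaves room for the evaluation points of all nodes and the colours. -/
def fieldBound (k n : ℕ) : ℕ := (n + 1) * numPoints k n + k

theorem nonColorability_mem_dStatZK_of_prime {k : ℕ} {p : ℕ → ℕ} (hp : ∀ n, (p n).Prime)
    (hle : ∀ n, fieldBound k n ≤ p n) :
    nonColorability k ∈ dStatZK Setup.rounds (fun n => 8 * Nat.clog 2 (p n)) (fun _ => 1)
      (fun n => (2 * n + 3) * Nat.clog 2 (p n)) := by
  have (n : ℕ) : Fact (p n).Prime := ⟨hp n⟩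
  have sizes_le (n : ℕ) : n * numPoints k n ≤ Fintype.card (ZMod (p n)) ∧
      numPoints k n ≤ Fintype.card (ZMod (p n)) ∧ k ≤ Fintype.card (ZMod (p n)) := by
    have bound_le := hle n
    rw [fieldBound, Nat.succ_mul] at bound_le
    rw [ZMod.card]
    lia
  have setup (n : ℕ) := (exists_setup (k := k) (sizes_le n).1 (sizes_le n).2.2).some
  simpa only [ZMod.card] using
    Setup.nonColorability_mem_dStatZK setup (fun n => (sizes_le n).2.1) fun n => le_rfl

theorem eventually_two_mul_fieldBound_le (k : ℕ) :
    ∀ᶠ n in atTop, 2 * fieldBound k n ≤ n ^ 4 := by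
  filter_upwards [eventually_ge_atTop (k + 40)] with n hn
  have numPoints_le : numPoints k n ≤ 9 * n ^ 2 := by
    rw [numPoints]
    nlinarith
  have k_le : k ≤ n ^ 3 := by nlinarith [Nat.le_self_pow three_ne_zero n]
  calc 2 * fieldBound k n ≤ 2 * ((2 * n) * (9 * n ^ 2) + n ^ 3) :=
        Nat.mul_le_mul_left 2 (add_le_add (Nat.mul_le_mul (by lia) numPoints_le) k_le)
    _ = 38 * n ^ 3 := by ring
    _ ≤ n * n ^ 3 := Nat.mul_le_mul_right _ (by lia)
    _ = n ^ 4 := by ring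

theorem clog_le_log {q : ℕ} (hq : 2 ≤ q) : (Nat.clog 2 q : ℝ) ≤ 3 * Real.log q := by
  have clog_le : (Nat.clog 2 q : ℝ) ≤ Nat.log 2 q + 1 := by
    exact_mod_cast Nat.clog_le_of_le_pow (Nat.lt_pow_succ_log_self one_lt_two q).le
  have log_le : (Nat.log 2 q : ℝ) ≤ Real.logb 2 q := by exact_mod_cast Real.natLog_le_logb q 2
  have log_two_le : Real.log 2 ≤ Real.log q := Real.log_le_log two_pos (by exact_mod_cast hq)
  have log_two_gt := Real.log_two_gt_d9
  have logb_mul : Real.logb 2 q * Real.log 2 = Real.log q := div_mul_cancel₀ _ (by linarith)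
  nlinarith

theorem eventually_clog_le (k : ℕ) {p : ℕ → ℕ} (hp : ∀ n, 2 ≤ p n)
    (hle : ∀ n, p n ≤ 2 * fieldBound k n) :
    ∀ᶠ n in atTop, (Nat.clog 2 (p n) : ℝ) ≤ 12 * Real.log n := by
  filter_upwards [eventually_two_mul_fieldBound_le k] with n hn
  have p_pos : (0 : ℝ) < p n := by exact_mod_cast two_pos.trans_le (hp n)
  calc (Nat.clog 2 (p n) : ℝ) ≤ 3 * Real.log (p n) := clog_le_log (hp n)
    _ ≤ 3 * Real.log ((n : ℝ) ^ 4) := by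
        gcongr
        exact_mod_cast (hle n).trans hn
    _ = 12 * Real.log n := by
        rw [Real.log_pow]
        push_cast
        ring

end NonColorability

theorem mainTheorem2_general :
    ∃ C : ℕ, ∀ k : ℕ, ∃ r l b : ℕ → ℕ,
      (∀ᶠ n in atTop,
        (r n : ℝ) ≤ C * (n : ℝ) ∧
        (l n : ℝ) ≤ C * Real.log n ∧
        (b n : ℝ) ≤ C * ((n : ℝ) * Real.log n)) ∧
      nonColorability k ∈ dStatZK r l (fun _ => 1) b := by
  refine ⟨96, fun k => ?_⟩
  have fieldBound_ne_zero (n : ℕ) : NonColorability.fieldBound k n ≠ 0 := by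
    simp [NonColorability.fieldBound, NonColorability.numPoints]
  choose p hp hlt hle using fun n =>
    Nat.exists_prime_lt_and_le_two_mul _ (fieldBound_ne_zero n)
  refine ⟨_, _, _, ?_,
    NonColorability.nonColorability_mem_dStatZK_of_prime hp fun n => (hlt n).le⟩
  filter_upwards [NonColorability.eventually_clog_le k (fun n => (hp n).two_le) hle,
    eventually_ge_atTop 1] with n clog_le hn
  have one_le : (1 : ℝ) ≤ n := by exact_mod_cast hn
  push_cast
  refine ⟨by linarith, by linarith, ?_⟩
  calc (2 * (n : ℝ) + 3) * Nat.clog 2 (p n) ≤ (8 * n) * (12 * Real.log n) := by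
        gcongr
        linarith
    _ = 96 * (n * Real.log n) := by ring

end

/-- For every `k` there are constants `C` and `c` such that for every superpolynomial sequence of
primes `q`, non-`k`-colorability is in `dStatZK[r, l, C[c, b]]` for some `r ≤ C n`, `l ≤ C log q` and
`b ≤ C n log q` (for all large `n`). -/
theorem mainTheorem2 (k : ℕ) :
    ∃ C c : ℕ, ∀ q : ℕ → ℕ, (∀ n, (q n).Prime) → IsSuperpolynomial q →
      ∃ r l b : ℕ → ℕ,
        (∀ᶠ n in Filter.atTop,
          (r n : ℝ) ≤ C * (n : ℝ) ∧
          (l n : ℝ) ≤ C * Real.log (q n) ∧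
          (b n : ℝ) ≤ C * ((n : ℝ) * Real.log (q n))) ∧
        nonColorability k ∈ dStatZK r l (fun _ => c) b := by
  obtain ⟨C, hC⟩ := mainTheorem2_general
  obtain ⟨r, l, b, bounds, mem⟩ := hC k
  refine ⟨C, 1, fun q _ hq => ⟨r, l, b, ?_, mem⟩⟩
  filter_upwards [bounds, hq 1, eventually_gt_atTop 0] with n ⟨hr, hl, hb⟩ hnq hn
  have log_le : Real.log n ≤ Real.log (q n) :=
    Real.log_le_log (by exact_mod_cast hn) (by exact_mod_cast (pow_one n).symm.trans_le hnq)
  exact ⟨hr, hl.trans (by gcongr), hb.trans (by gcongr)⟩
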